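/- Let $(M,g)$ be an oriented smooth $4$-manifold with a Lorentzian metric of signature $(-,+,+,+)$ and of Petrov type $D$, i.e. at every point the Weyl tensor is nonzero and has two distinct double principal null directions. Let $\nabla$ be the Levi-Civita connection of $g$, and let $k_+,k_-$ be smooth null (hence nowhere vanishing) vector fields with $g(k_+,k_-)<0$, with $k_+$ geodesic ($\nabla_{k_+}k_+=0$) and $k_-$ pre-geodesic ($\nabla_{k_-}k_-=\alpha k_-$ for some smooth function $\alpha$). Put $\mathcal V=\mathrm{span}(k_+,k_-)$ and $\mathcal H=\mathcal V^{\perp}$, let $\pi\colon TM=\mathcal V\oplus\mathcal H\to\mathcal H$ be the projection, and orient $\mathcal H$ so that the orientation of $\mathcal V$ given by $(k_+,k_-)$ followed by that of $\mathcal H$ is the orientation of $M$. For a vector field $X$ with values in $\mathcal V$ let $\nabla^{o}X$ denote the trace-free symmetric part of the operator $\pi\circ\nabla X|_{\mathcal H}$ on $\mathcal H$, and let $\iota^{X}=g(\nabla_{y}X,x)-g(\nabla_{x}X,y)$ for any oriented orthonormal frame $(x,y)$ of $\mathcal H$. Assume that $k_\pm$ are shear-free, i.e. $\nabla^{o}k_\pm=0$.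 Let $J=J_{g,k_\pm}$ be the almost complex structure on $M$ with $Jk_+=k_-$, $Jk_-=-k_+$ which preserves $\mathcal H$ and acts on it as the isometry with square $-1$ compatible with the orientation of $\mathcal H$ (that is, $(v,Jv)$ is positively oriented for $0\ne v\in\mathcal H$). Assume that $g|_{\mathcal H}$ is positive definite, that $k_+,k_-$ are everywhere linearly independent, and that $J$ is an admissible complex structure, that is, (i) $[k_\pm,\Gamma(\mathcal H)]\subset\Gamma(\mathcal H)$ and (ii) $J\nabla^{o}k_+=\nabla^{o}(Jk_+)$ on $\mathcal H$. Set $p:=1/\sqrt{-g(k_+,k_-)}$. Let $u$ be a smooth function on $M$ and $f$ a smooth positive function defined on the range of $u$, such that the gradient $\nabla(f(u)/p)$ is a section of $\mathcal V$. Then, with $k_+^\flat=g(k_+,\cdot)$, \[ g_K=d\bigl(f(u)\,p\,k_+^\flat\bigr)(\cdot,J\cdot) \] is a Kähler metric with respect to $J$ on every open set on which $\iota^{k_+}<0$ and $d_{k_+}(f(u)p)<0$: there $J$ is a smooth integrable almost complex structure (its Nijenhuis tensor vanishes), $g_K$ is a smooth $J$-invariant Riemannian metric, and the $2$-form $g_K(J\cdot,\cdot)$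 is closed. -/

import Mathlib

open scoped Manifold ContDiff Topology
open Bundle VectorField

noncomputable section
namespace KahlerLorentz

/-- The model space of the manifolds below. -/
abbrev E4 : Type := EuclideanSpace ℝ (Fin 4)

section Metric
variable (M : Type*) [TopologicalSpace M] [ChartedSpace E4 M]

/-- Vector fields, as set-theoretic sections of the tangent bundle. -/
abbrev VField : Type _ := (x : M) → TangentSpace (𝓡 4) x

/-- A smooth semi-Riemannian metric on a `4`-manifold. -/
structure SemiRiemannianMetric [IsManifold (𝓡 4) ∞ M] where
  inner (x : M) : TangentSpace (𝓡 4) x →L[ℝ] TangentSpace (𝓡 4) x →L[ℝ] ℝ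
  symm (x : M) (v w : TangentSpace (𝓡 4) x) : inner x v w = inner x w v
  nondegenerate (x : M) (v : TangentSpace (𝓡 4) x) (hv : ∀ w, inner x v w = 0) : v = 0
  contMDiff : ContMDiff (𝓡 4) ((𝓡 4).prod 𝓘(ℝ, E4 →L[ℝ] E4 →L[ℝ] ℝ)) ∞
    (fun x ↦ TotalSpace.mk' (E4 →L[ℝ] E4 →L[ℝ] ℝ)
      (E := fun x : M ↦ TangentSpace (𝓡 4) x →L[ℝ] TangentSpace (𝓡 4) x →L[ℝ] ℝ) x (inner x))
end Metric

instance {M : Type*} [TopologicalSpace M] [ChartedSpace E4 M] (x : M) :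
    FiniteDimensional ℝ (TangentSpace (𝓡 4) x) :=
  inferInstanceAs (FiniteDimensional ℝ E4)

instance {M : Type*} [TopologicalSpace M] [ChartedSpace E4 M] (x : M) :
    T2Space (TangentSpace (𝓡 4) x) :=
  inferInstanceAs (T2Space E4)

variable {M : Type*} [TopologicalSpace M] [ChartedSpace E4 M] [IsManifold (𝓡 4) ∞ M]

/-- The standard basis of a tangent space, that of the preferred chart at the point. -/
def tangentBasis {M : Type*} [TopologicalSpace M] [ChartedSpace E4 M] (x : M) :
    Module.Basis (Fin 4) ℝ (TangentSpace (𝓡 4) x) :=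
  (EuclideanSpace.basisFun (Fin 4) ℝ).toBasis

/-- Smoothness of a vector field on a set. -/
def SmoothOn (X : VField M) (U : Set M) : Prop :=
  ContMDiffOn (𝓡 4) ((𝓡 4).prod 𝓘(ℝ, E4)) ∞ (fun y ↦ TotalSpace.mk' E4 y (X y)) U

variable (M) in
/-- An orientation of a `4`-manifold: an orientation of each tangent space that is given, near
each point, by a smooth local frame. -/
structure TangentOrientation where
  orient (x : M) : Orientation ℝ (TangentSpace (𝓡 4) x) (Fin 4)
  locally_frame (x : M) : ∃ U ∈ 𝓝 x, ∃ e : (y : M) → Module.Basis (Fin 4) ℝ (TangentSpace (𝓡 4) y),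
    (∀ i, SmoothOn (fun y ↦ e y i) U) ∧ ∀ y ∈ U, (e y).orientation = orient y

/-- `v` is a positively oriented basis of the tangent space. -/
def TangentOrientation.IsPositive (o : TangentOrientation M) (x : M)
    (v : Fin 4 → TangentSpace (𝓡 4) x) : Prop :=
  ∃ b : Module.Basis (Fin 4) ℝ (TangentSpace (𝓡 4) x), ⇑b = v ∧ b.orientation = o.orient x

/-- `V = span(k₊, k₋)`. -/
def vertical (kp km : VField M) (x : M) : Submodule ℝ (TangentSpace (𝓡 4) x) :=
  Submodule.span ℝ {kp x, km x}

/-- Differentiability of a vector field at a point. -/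
abbrev DiffAt (X : VField M) (x : M) : Prop :=
  MDifferentiableAt (𝓡 4) ((𝓡 4).prod 𝓘(ℝ, E4)) (fun y ↦ TotalSpace.mk' E4 y (X y)) x

namespace SemiRiemannianMetric
variable (g : SemiRiemannianMetric M)

/-- The metric at a point, as a bilinear form. -/
def bilin (x : M) : LinearMap.BilinForm ℝ (TangentSpace (𝓡 4) x) :=
  LinearMap.mk₂ ℝ (fun v w ↦ g.inner x v w) (by simp) (by simp) (by simp) (by simp)

@[simp] theorem bilin_apply (x : M) (v w : TangentSpace (𝓡 4) x) :
    g.bilin x v w = g.inner x v w := rfl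

theorem bilin_nondegenerate (x : M) : (g.bilin x).Nondegenerate :=
  ⟨fun v hv ↦ g.nondegenerate x v hv,
    fun v hv ↦ g.nondegenerate x v (fun w ↦ by rw [g.symm]; exact hv w)⟩

/-- The musical isomorphism `♯`: `g (φ♯, ·) = φ`. -/
def sharp (x : M) : Module.Dual ℝ (TangentSpace (𝓡 4) x) →ₗ[ℝ] TangentSpace (𝓡 4) x :=
  ((g.bilin x).toDual (g.bilin_nondegenerate x)).symm.toLinearMap

theorem inner_sharp (x : M) (φ : Module.Dual ℝ (TangentSpace (𝓡 4) x))
    (w : TangentSpace (𝓡 4) x) : g.inner x (g.sharp x φ) w = φ w :=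
  LinearMap.BilinForm.apply_toDual_symm_apply (hB := g.bilin_nondegenerate x) φ w

theorem ext_inner {x : M} {v w : TangentSpace (𝓡 4) x}
    (h : ∀ z, g.inner x v z = g.inner x w z) : v = w := by
  rw [← sub_eq_zero]
  exact g.nondegenerate x _ fun z ↦ by simp [h z]


theorem mdifferentiableAt_inner {X Y : VField M} {x : M}
    (hX : DiffAt X x) (hY : DiffAt Y x) :
    MDifferentiableAt (𝓡 4) 𝓘(ℝ) (fun y ↦ g.inner y (X y) (Y y)) x := by
  have h : MDifferentiableAt (𝓡 4) ((𝓡 4).prod 𝓘(ℝ))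
      (fun m ↦ TotalSpace.mk' ℝ (E := Bundle.Trivial M ℝ) m (g.inner m (X m) (Y m))) x := by
    apply MDifferentiableAt.clm_bundle_apply₂ (F₁ := E4) (F₂ := E4)
    · exact g.contMDiff.mdifferentiableAt (by simp)
    · exact hX
    · exact hY
  simp only [mdifferentiableAt_totalSpace] at h
  exact h.2

/-- Twice `g (∇_X Y, Z)` for the Levi-Civita connection, by the Koszul formula. -/
def koszul (Y X Z : VField M) (x : M) : ℝ :=
  mvfderiv (𝓡 4) (fun y ↦ g.inner y (Y y) (Z y)) x (X x)
    + mvfderiv (𝓡 4) (fun y ↦ g.inner y (Z y) (X y)) x (Y x)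
    - mvfderiv (𝓡 4) (fun y ↦ g.inner y (X y) (Y y)) x (Z x)
    + g.inner x (mlieBracket (𝓡 4) X Y x) (Z x)
    - g.inner x (mlieBracket (𝓡 4) Y Z x) (X x)
    + g.inner x (mlieBracket (𝓡 4) Z X x) (Y x)

theorem koszul_add₁ {Y Y' X Z : VField M} {x : M} (hY : DiffAt Y x) (hY' : DiffAt Y' x)
    (hX : DiffAt X x) (hZ : DiffAt Z x) :
    g.koszul (Y + Y') X Z x = g.koszul Y X Z x + g.koszul Y' X Z x := by
  have h1 := mvfderiv_fun_add (g.mdifferentiableAt_inner hY hZ) (g.mdifferentiableAt_inner hY' hZ)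
  have h2 := mvfderiv_fun_add (g.mdifferentiableAt_inner hX hY) (g.mdifferentiableAt_inner hX hY')
  simp only [koszul, Pi.add_apply, map_add, add_apply, h1, h2,
    mlieBracket_add_right hY hY', mlieBracket_add_left hY hY']
  ring

theorem koszul_smul₁ {Y X Z : VField M} {f : M → ℝ} {x : M}
    (hf : MDifferentiableAt (𝓡 4) 𝓘(ℝ) f x) (hY : DiffAt Y x)
    (hX : DiffAt X x) (hZ : DiffAt Z x) :
    g.koszul (f • Y) X Z x = f x * g.koszul Y X Z x
      + 2 * (mvfderiv (𝓡 4) f x (X x) * g.inner x (Y x) (Z x)) := by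
  have h1 := mvfderiv_fun_mul hf (g.mdifferentiableAt_inner hY hZ)
  have h2 := mvfderiv_fun_mul hf (g.mdifferentiableAt_inner hX hY)
  simp only [koszul, Pi.smul_apply', map_smul, smul_apply, smul_eq_mul, h1, h2,
    mlieBracket_smul_right hf hY, mlieBracket_smul_left hf hY, map_add, 
    add_apply, g.symm x (Y x) (X x), neg_apply, map_neg, neg_smul]
  ring


theorem koszul_add_koszul (X Y Z : VField M) (x : M) :
    g.koszul Y X Z x + g.koszul Z X Y x
      = 2 * mvfderiv (𝓡 4) (fun y ↦ g.inner y (Y y) (Z y)) x (X x) := by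
  have e1 : (fun y ↦ g.inner y (Z y) (Y y)) = fun y ↦ g.inner y (Y y) (Z y) :=
    funext fun y ↦ g.symm ..
  have e2 : (fun y ↦ g.inner y (X y) (Z y)) = fun y ↦ g.inner y (Z y) (X y) :=
    funext fun y ↦ g.symm ..
  have e3 : (fun y ↦ g.inner y (Y y) (X y)) = fun y ↦ g.inner y (X y) (Y y) :=
    funext fun y ↦ g.symm ..
  simp only [koszul, e1, e2, e3, mlieBracket_swap_apply (V := Z) (W := X),
    mlieBracket_swap_apply (V := Z) (W := Y), mlieBracket_swap_apply (V := Y) (W := X),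
    map_neg, neg_apply]
  ring

theorem koszul_sub_koszul (X Y Z : VField M) (x : M) :
    g.koszul Y X Z x - g.koszul X Y Z x = 2 * g.inner x (mlieBracket (𝓡 4) X Y x) (Z x) := by
  have e2 : (fun y ↦ g.inner y (X y) (Z y)) = fun y ↦ g.inner y (Z y) (X y) :=
    funext fun y ↦ g.symm ..
  have e1 : (fun y ↦ g.inner y (Z y) (Y y)) = fun y ↦ g.inner y (Y y) (Z y) :=
    funext fun y ↦ g.symm ..
  have e3 : (fun y ↦ g.inner y (Y y) (X y)) = fun y ↦ g.inner y (X y) (Y y) :=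
    funext fun y ↦ g.symm ..
  simp only [koszul, e1, e2, e3, mlieBracket_swap_apply (V := Z) (W := X),
    mlieBracket_swap_apply (V := Z) (W := Y), mlieBracket_swap_apply (V := Y) (W := X),
    map_neg, neg_apply]
  ring

theorem koszul_tensorial₃ {X Y : VField M} {x : M} (hY : DiffAt Y x) (hX : DiffAt X x) :
    TensorialAt (𝓡 4) E4 (g.koszul Y X · x) x where
  smul {f Z} hf hZ := by
    have h1 := g.koszul_add_koszul X Y (f • Z) x
    have h2 := g.koszul_add_koszul X Y Z x
    have h3 := g.koszul_smul₁ hf hZ hX hY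
    have h4 := mvfderiv_fun_mul hf (g.mdifferentiableAt_inner hY hZ)
    simp only [Pi.smul_apply', map_smul, smul_apply, smul_eq_mul, h4, add_apply,
      g.symm x (Z x) (Y x)] at *
    linear_combination h1 - h3 - f x * h2
  add {Z Z'} hZ hZ' := by
    have h1 := g.koszul_add_koszul X Y (Z + Z') x
    have h2 := g.koszul_add_koszul X Y Z x
    have h2' := g.koszul_add_koszul X Y Z' x
    have h3 := g.koszul_add₁ hZ hZ' hX hY
    have h4 := mvfderiv_fun_add (g.mdifferentiableAt_inner hY hZ) (g.mdifferentiableAt_inner hY hZ')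
    simp only [Pi.add_apply, map_add, h4, add_apply] at *
    linear_combination h1 - h3 - h2 - h2'

theorem koszul_tensorial₂ {Y Z : VField M} {x : M} (hY : DiffAt Y x) (hZ : DiffAt Z x) :
    TensorialAt (𝓡 4) E4 (g.koszul Y · Z x) x where
  smul {f X} hf hX := by
    have h1 := g.koszul_sub_koszul (f • X) Y Z x
    have h2 := g.koszul_sub_koszul X Y Z x
    have h3 := g.koszul_smul₁ hf hX hY hZ
    simp only [mlieBracket_smul_left hf hX, map_smul, smul_apply, smul_eq_mul, add_apply, map_add,
      neg_smul, map_neg, neg_apply] at *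
    linear_combination h1 + h3 - f x * h2
  add {X X'} hX hX' := by
    have h1 := g.koszul_sub_koszul (X + X') Y Z x
    have h2 := g.koszul_sub_koszul X Y Z x
    have h2' := g.koszul_sub_koszul X' Y Z x
    have h3 := g.koszul_add₁ hX hX' hY hZ
    simp only [mlieBracket_add_left hX hX', add_apply, map_add] at *
    linear_combination h1 + h3 - h2 - h2'

/-- The bilinear form `(v, w) ↦ 2 g (∇_v Y, w)` at a point. -/
def koszulHom (Y : VField M) (x : M) (hY : DiffAt Y x) :
    TangentSpace (𝓡 4) x →L[ℝ] TangentSpace (𝓡 4) x →L[ℝ] ℝ :=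
  TensorialAt.mkHom₂ (I := 𝓡 4) (F := E4) (F' := E4) (fun X Z ↦ g.koszul Y X Z x) x
    (fun _ hZ ↦ g.koszul_tensorial₂ hY hZ) (fun _ hX ↦ g.koszul_tensorial₃ hY hX)

theorem koszulHom_apply {Y X Z : VField M} {x : M} (hY : DiffAt Y x) (hX : DiffAt X x)
    (hZ : DiffAt Z x) : g.koszulHom Y x hY (X x) (Z x) = g.koszul Y X Z x :=
  TensorialAt.mkHom₂_apply (I := 𝓡 4) (F := E4) (F' := E4) _ _ hX hZ

open Classical in
/-- The covariant derivative `v ↦ ∇_v Y` (zero where `Y` is not differentiable). -/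
def leviCivitaFun (Y : VField M) (x : M) :
    TangentSpace (𝓡 4) x →L[ℝ] TangentSpace (𝓡 4) x :=
  if hY : DiffAt Y x then
    LinearMap.toContinuousLinearMap
      { toFun := fun v ↦ (2⁻¹ : ℝ) • g.sharp x (g.koszulHom Y x hY v).toLinearMap
        map_add' := fun v w ↦ by simp
        map_smul' := fun c v ↦ by simp [smul_comm c] }
  else 0

theorem inner_leviCivitaFun {Y X Z : VField M} {x : M} (hY : DiffAt Y x) (hX : DiffAt X x)
    (hZ : DiffAt Z x) :
    2 * g.inner x (g.leviCivitaFun Y x (X x)) (Z x) = g.koszul Y X Z x := by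
  rw [leviCivitaFun, dif_pos hY, ← g.koszulHom_apply hY hX hZ]
  simp [g.inner_sharp]

theorem leviCivitaFun_ext {x : M} {v w : TangentSpace (𝓡 4) x}
    (h : ∀ Z : VField M, DiffAt Z x → 2 * g.inner x v (Z x) = 2 * g.inner x w (Z x)) : v = w :=
  g.ext_inner fun z ↦ by
    have := h (FiberBundle.extend E4 z) (FiberBundle.mdifferentiableAt_extend ..)
    simpa using this

/-- The Levi-Civita connection of `g`. -/
def leviCivita : CovariantDerivative (𝓡 4) E4 (TangentSpace (𝓡 4) : M → Type _) where
  toFun := g.leviCivitaFun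
  isCovariantDerivativeOnUniv :=
    { add := by
        intro Y Y' x hY hY' _
        ext1 v
        refine g.leviCivitaFun_ext fun Z hZ ↦ ?_
        obtain ⟨X, hX, rfl⟩ : ∃ X : VField M, DiffAt X x ∧ X x = v :=
          ⟨FiberBundle.extend E4 v, FiberBundle.mdifferentiableAt_extend .., by simp⟩
        have hs : DiffAt (Y + Y') x := mdifferentiableAt_add_section hY hY'
        rw [g.inner_leviCivitaFun hs hX hZ, g.koszul_add₁ hY hY' hX hZ,
          ← g.inner_leviCivitaFun hY hX hZ, ← g.inner_leviCivitaFun hY' hX hZ]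
        simp [mul_add]
      leibniz := by
        intro Y f x hY hf _
        ext1 v
        refine g.leviCivitaFun_ext fun Z hZ ↦ ?_
        obtain ⟨X, hX, rfl⟩ : ∃ X : VField M, DiffAt X x ∧ X x = v :=
          ⟨FiberBundle.extend E4 v, FiberBundle.mdifferentiableAt_extend .., by simp⟩
        have hs : DiffAt (f • Y) x := hf.smul_section hY
        rw [g.inner_leviCivitaFun hs hX hZ, g.koszul_smul₁ hf hY hX hZ,
          ← g.inner_leviCivitaFun hY hX hZ]
        simp
        ring }

/-- The Levi-Civita connection is metric. -/
theorem leviCivita_metric {X Y Z : VField M} {x : M} (hX : DiffAt X x) (hY : DiffAt Y x)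
    (hZ : DiffAt Z x) :
    mvfderiv (𝓡 4) (fun y ↦ g.inner y (Y y) (Z y)) x (X x)
      = g.inner x (g.leviCivita Y x (X x)) (Z x) + g.inner x (Y x) (g.leviCivita Z x (X x)) := by
  have h1 := g.koszul_add_koszul X Y Z x
  rw [← g.inner_leviCivitaFun hY hX hZ, ← g.inner_leviCivitaFun hZ hX hY,
    g.symm x _ (Y x)] at h1
  change _ = g.inner x (g.leviCivitaFun Y x (X x)) (Z x)
    + g.inner x (Y x) (g.leviCivitaFun Z x (X x))
  linarith

/-- The Levi-Civita connection is torsion-free. -/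
theorem leviCivita_torsion {X Y : VField M} {x : M} (hX : DiffAt X x) (hY : DiffAt Y x) :
    g.leviCivita Y x (X x) - g.leviCivita X x (Y x) = mlieBracket (𝓡 4) X Y x := by
  refine g.leviCivitaFun_ext fun Z hZ ↦ ?_
  rw [← g.koszul_sub_koszul X Y Z x, ← g.inner_leviCivitaFun hY hX hZ,
    ← g.inner_leviCivitaFun hX hY hZ]
  simp [mul_sub, leviCivita]

/-- `g` is Lorentzian, of signature `(-,+,+,+)`. -/
def IsLorentzian : Prop :=
  ∀ x, ∃ t : TangentSpace (𝓡 4) x, g.inner x t t < 0 ∧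
    ∀ v, g.inner x t v = 0 → v ≠ 0 → 0 < g.inner x v v

/-- The gradient of a function. -/
def gradient (φ : M → ℝ) (x : M) : TangentSpace (𝓡 4) x :=
  g.sharp x (mvfderiv (𝓡 4) φ x).toLinearMap

/-- The curvature endomorphism
`R(u,v)w = ∇_u ∇_V W - ∇_v ∇_U W - ∇_{[U,V]} W`, where `U, V, W` extend `u, v, w`. -/
def curvature (x : M) (u v w : TangentSpace (𝓡 4) x) : TangentSpace (𝓡 4) x :=
  let U : VField M := FiberBundle.extend E4 u
  let V : VField M := FiberBundle.extend E4 v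
  let W : VField M := FiberBundle.extend E4 w
  g.leviCivita (fun y ↦ g.leviCivita W y (V y)) x u
    - g.leviCivita (fun y ↦ g.leviCivita W y (U y)) x v
    - g.leviCivita W x (mlieBracket (𝓡 4) U V x)

/-- The Ricci curvature, `Ric(v,w) = tr (a ↦ R(a,v)w)`. -/
def ricci (x : M) (v w : TangentSpace (𝓡 4) x) : ℝ :=
  ∑ i, (tangentBasis x).coord i (g.curvature x (tangentBasis x i) v w)

/-- The scalar curvature, the metric trace of the Ricci curvature. -/
def scalarCurvature (x : M) : ℝ :=
  ∑ i, ∑ j, (Matrix.of fun i j ↦ g.inner x (tangentBasis x i) (tangentBasis x j))⁻¹ i j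
    * g.ricci x (tangentBasis x i) (tangentBasis x j)

/-- The Weyl curvature tensor of a metric in dimension four. -/
def weyl (x : M) (a b c d : TangentSpace (𝓡 4) x) : ℝ :=
  g.inner x (g.curvature x a b d) c
    - 2⁻¹ * (g.inner x a c * g.ricci x b d - g.inner x a d * g.ricci x b c
      + g.inner x b d * g.ricci x a c - g.inner x b c * g.ricci x a d)
    + g.scalarCurvature x / 6
      * (g.inner x a c * g.inner x b d - g.inner x a d * g.inner x b c)

/-- `l` spans a repeated principal null direction of the Weyl tensor at `x` (Bel's criterion
`l^b l^c C_{abc[d} l_{e]} = 0`; in a null tetrad starting with `l` it reads `Ψ₀ = Ψ₁ = 0`). -/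
def IsRepeatedPND (x : M) (l : TangentSpace (𝓡 4) x) : Prop :=
  l ≠ 0 ∧ g.inner x l l = 0 ∧
    ∀ a d e, g.weyl x a l l d * g.inner x l e = g.weyl x a l l e * g.inner x l d

/-- Petrov type `D`: a Lorentzian metric whose Weyl tensor at each point is nonzero and has two
distinct repeated (hence exactly double) principal null directions. -/
def IsPetrovTypeD : Prop :=
  g.IsLorentzian ∧ ∀ x, (∃ a b c d, g.weyl x a b c d ≠ 0) ∧
    ∃ l n, LinearIndependent ℝ ![l, n] ∧ g.IsRepeatedPND x l ∧ g.IsRepeatedPND x n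

/-- A null vector field: nowhere vanishing with `g (k, k) = 0`. -/
def IsNull (k : VField M) : Prop := ∀ x, k x ≠ 0 ∧ g.inner x (k x) (k x) = 0

/-- A geodesic vector field: `∇_k k = 0`. -/
def IsGeodesic (k : VField M) : Prop := ∀ x, g.leviCivita k x (k x) = 0

/-- A pre-geodesic vector field: `∇_k k = α k` for a smooth function `α`. -/
def IsPreGeodesic (k : VField M) : Prop :=
  ∃ α : M → ℝ, ContMDiff (𝓡 4) 𝓘(ℝ) ∞ α ∧ ∀ x, g.leviCivita k x (k x) = α x • k x

/-- `H = span(k₊, k₋)^⊥`. -/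
def horizontal (kp km : VField M) (x : M) : Submodule ℝ (TangentSpace (𝓡 4) x) :=
  LinearMap.ker (g.bilin x (kp x)) ⊓ LinearMap.ker (g.bilin x (km x))

/-- The projection `π : TM = V ⊕ H → H`, written out with the inverse of the Gram matrix of
`k₊, k₋`. -/
def projH (kp km : VField M) (x : M) : TangentSpace (𝓡 4) x →ₗ[ℝ] TangentSpace (𝓡 4) x :=
  let pp := g.inner x (kp x) (kp x)
  let pm := g.inner x (kp x) (km x)
  let mm := g.inner x (km x) (km x)
  LinearMap.id
    - ((pp * mm - pm ^ 2)⁻¹ •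
        (mm • g.bilin x (kp x) - pm • g.bilin x (km x))).smulRight (kp x)
    - ((pp * mm - pm ^ 2)⁻¹ •
        (pp • g.bilin x (km x) - pm • g.bilin x (kp x))).smulRight (km x)

/-- The operator `π ∘ ∇X |_H`, extended by zero on `V`. -/
def relNabla (kp km X : VField M) (x : M) :
    TangentSpace (𝓡 4) x →ₗ[ℝ] TangentSpace (𝓡 4) x :=
  g.projH kp km x ∘ₗ (g.leviCivita X x).toLinearMap ∘ₗ g.projH kp km x

/-- The relative shear operator of `X`: the trace-free symmetric part of `π ∘ ∇X |_H` (extended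
by zero on `V`), where `H` has rank two. -/
def relShear (kp km X : VField M) (x : M) :
    TangentSpace (𝓡 4) x →ₗ[ℝ] TangentSpace (𝓡 4) x :=
  (2⁻¹ : ℝ) • (g.relNabla kp km X x
      + (g.bilin x).leftAdjointOfNondegenerate (g.bilin_nondegenerate x) (g.relNabla kp km X x))
    - (2⁻¹ * LinearMap.trace ℝ _ (g.relNabla kp km X x)) • g.projH kp km x

/-- `X` is shear-free relative to `TM = V ⊕ H`. -/
def IsShearFree (kp km X : VField M) : Prop :=
  ∀ x, ∀ v ∈ g.horizontal kp km x, g.relShear kp km X x v = 0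

/-- `a, b` is an oriented orthonormal frame of `H` at `x`; `H` is oriented so that the
orientations of `V` (given by `k₊, k₋`) and `H` induce that of `M`. -/
structure IsOrientedFrame (o : TangentOrientation M) (kp km : VField M) (x : M)
    (a b : TangentSpace (𝓡 4) x) : Prop where
  left_mem : a ∈ g.horizontal kp km x
  right_mem : b ∈ g.horizontal kp km x
  left_unit : g.inner x a a = 1
  right_unit : g.inner x b b = 1
  orthogonal : g.inner x a b = 0
  oriented : o.IsPositive x ![kp x, km x, a, b]

/-- The twist function `ι^X = g (∇_b X, a) - g (∇_a X, b)` in a frame `a, b` of `H`; the value is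
the same for all oriented orthonormal frames. -/
def twist (X : VField M) (x : M) (a b : TangentSpace (𝓡 4) x) : ℝ :=
  g.inner x (g.leviCivita X x b) a - g.inner x (g.leviCivita X x a) b

/-- `J` is the almost complex structure `J_{g,k₊,k₋}`, with `k₊, k₋` pointwise independent and
`H` spacelike. -/
structure IsAdmissibleAlmostComplex (o : TangentOrientation M) (kp km : VField M)
    (J : (x : M) → TangentSpace (𝓡 4) x →L[ℝ] TangentSpace (𝓡 4) x) : Prop where
  linearIndependent : ∀ x, LinearIndependent ℝ ![kp x, km x]
  spacelike : ∀ x, ∀ v ∈ g.horizontal kp km x, v ≠ 0 → 0 < g.inner x v v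
  map_kp : ∀ x, J x (kp x) = km x
  map_km : ∀ x, J x (km x) = -kp x
  map_horizontal : ∀ x, ∀ v ∈ g.horizontal kp km x, J x v ∈ g.horizontal kp km x
  sq_horizontal : ∀ x, ∀ v ∈ g.horizontal kp km x, J x (J x v) = -v
  isometry_horizontal : ∀ x, ∀ v ∈ g.horizontal kp km x, ∀ w ∈ g.horizontal kp km x,
    g.inner x (J x v) (J x w) = g.inner x v w
  oriented_horizontal : ∀ x, ∀ v ∈ g.horizontal kp km x, v ≠ 0 →
    o.IsPositive x ![kp x, km x, v, J x v]

/-- `J` is an admissible complex structure: in addition `[k±, Γ(H)] ⊆ Γ(H)`, and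
`J ∘ ∇ᵒk₊ = ∇ᵒ(J k₊)` on `H`. -/
structure IsAdmissibleComplex (o : TangentOrientation M) (kp km : VField M)
    (J : (x : M) → TangentSpace (𝓡 4) x →L[ℝ] TangentSpace (𝓡 4) x) : Prop
    extends g.IsAdmissibleAlmostComplex o kp km J where
  bracket_kp : ∀ X : VField M, SmoothOn X Set.univ → (∀ x, X x ∈ g.horizontal kp km x) →
    ∀ x, mlieBracket (𝓡 4) kp X x ∈ g.horizontal kp km x
  bracket_km : ∀ X : VField M, SmoothOn X Set.univ → (∀ x, X x ∈ g.horizontal kp km x) →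
    ∀ x, mlieBracket (𝓡 4) km X x ∈ g.horizontal kp km x
  shear : ∀ x, ∀ v ∈ g.horizontal kp km x,
    J x (g.relShear kp km kp x v) = g.relShear kp km (fun y ↦ J y (kp y)) x v

end SemiRiemannianMetric

section Kahler

/-- The exterior derivative of a `1`-form, evaluated on vector fields. -/
def dOneForm (α : (x : M) → TangentSpace (𝓡 4) x →L[ℝ] ℝ) (X Y : VField M) (x : M) : ℝ :=
  mvfderiv (𝓡 4) (fun y ↦ α y (Y y)) x (X x) - mvfderiv (𝓡 4) (fun y ↦ α y (X y)) x (Y x)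
    - α x (mlieBracket (𝓡 4) X Y x)

/-- The exterior derivative of a `1`-form, evaluated on tangent vectors at `x` (by means of
arbitrary smooth extensions). -/
def dOneFormAt (α : (x : M) → TangentSpace (𝓡 4) x →L[ℝ] ℝ) (x : M)
    (v w : TangentSpace (𝓡 4) x) : ℝ :=
  dOneForm α (FiberBundle.extend E4 v) (FiberBundle.extend E4 w) x

/-- The exterior derivative of a `2`-form, evaluated on vector fields. -/
def dTwoForm (θ : (x : M) → TangentSpace (𝓡 4) x → TangentSpace (𝓡 4) x → ℝ)
    (X Y Z : VField M) (x : M) : ℝ :=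
  mvfderiv (𝓡 4) (fun y ↦ θ y (Y y) (Z y)) x (X x)
    - mvfderiv (𝓡 4) (fun y ↦ θ y (X y) (Z y)) x (Y x)
    + mvfderiv (𝓡 4) (fun y ↦ θ y (X y) (Y y)) x (Z x)
    - θ x (mlieBracket (𝓡 4) X Y x) (Z x) + θ x (mlieBracket (𝓡 4) X Z x) (Y x)
    - θ x (mlieBracket (𝓡 4) Y Z x) (X x)

/-- The Nijenhuis tensor `N(X,Y) = [JX,JY] - J[JX,Y] - J[X,JY] - [X,Y]`. -/
def nijenhuis (J : (x : M) → TangentSpace (𝓡 4) x →L[ℝ] TangentSpace (𝓡 4) x)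
    (X Y : VField M) (x : M) : TangentSpace (𝓡 4) x :=
  mlieBracket (𝓡 4) (fun y ↦ J y (X y)) (fun y ↦ J y (Y y)) x
    - J x (mlieBracket (𝓡 4) (fun y ↦ J y (X y)) Y x)
    - J x (mlieBracket (𝓡 4) X (fun y ↦ J y (Y y)) x)
    - mlieBracket (𝓡 4) X Y x

/-- On the open set `U`, `(J, h)` is a Kähler structure: `J` is a smooth integrable almost complex
structure, `h` is a smooth `J`-invariant Riemannian metric, and the fundamental form `h (J·, ·)`
is closed. -/
structure IsKahlerOn (U : Set M)
    (J : (x : M) → TangentSpace (𝓡 4) x →L[ℝ] TangentSpace (𝓡 4) x)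
    (h : (x : M) → TangentSpace (𝓡 4) x →L[ℝ] TangentSpace (𝓡 4) x →L[ℝ] ℝ) : Prop where
  smooth_J : ContMDiffOn (𝓡 4) ((𝓡 4).prod 𝓘(ℝ, E4 →L[ℝ] E4)) ∞
    (fun x ↦ TotalSpace.mk' (E4 →L[ℝ] E4)
      (E := fun x : M ↦ TangentSpace (𝓡 4) x →L[ℝ] TangentSpace (𝓡 4) x) x (J x)) U
  sq_J : ∀ x ∈ U, ∀ v, J x (J x v) = -v
  integrable_J : ∀ X Y : VField M, SmoothOn X U → SmoothOn Y U →
    ∀ x ∈ U, nijenhuis J X Y x = 0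
  smooth_metric : ContMDiffOn (𝓡 4) ((𝓡 4).prod 𝓘(ℝ, E4 →L[ℝ] E4 →L[ℝ] ℝ)) ∞
    (fun x ↦ TotalSpace.mk' (E4 →L[ℝ] E4 →L[ℝ] ℝ)
      (E := fun x : M ↦ TangentSpace (𝓡 4) x →L[ℝ] TangentSpace (𝓡 4) x →L[ℝ] ℝ) x (h x)) U
  symm : ∀ x ∈ U, ∀ v w, h x v w = h x w v
  pos : ∀ x ∈ U, ∀ v, v ≠ 0 → 0 < h x v v
  hermitian : ∀ x ∈ U, ∀ v w, h x (J x v) (J x w) = h x v w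
  closed : ∀ X Y Z : VField M, SmoothOn X U → SmoothOn Y U → SmoothOn Z U →
    ∀ x ∈ U, dTwoForm (fun y v w ↦ h y (J y v) w) X Y Z x = 0

end Kahler
end KahlerLorentz
end

open KahlerLorentz

noncomputable section
namespace KahlerLorentz

variable {M : Type*} [TopologicalSpace M] [ChartedSpace E4 M] [IsManifold (𝓡 4) ∞ M]

/-! Write `q = f(u) p` and `α = q k₊♭`, so that `g_K = dα(·, J·)`. Everything is read off in a local
unitary frame `k₊, k₋, a, b = J a`.

Closedness: once `dα` is `J`-invariant, `g_K(J·, ·) = dα(J·, J·) = dα`, which is exact, and `d ∘ d =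
0` (`dTwoForm_dOneForm`). Invariance also makes `g_K` symmetric and Hermitian.

Invariance and positivity: `dα` has block form in the frame. The mixed terms vanish because brackets
of `k±` with horizontal fields are horizontal and because `q g(k₊, k₋) = -f(u)/p` has vertical
gradient. On `V` the geodesic equation leaves `dα(k₊, k₋) = dq(k₊) g(k₊, k₋)`, and on `H` one finds
`dα(a, b) = -q ι`; both are positive under the sign hypotheses. A skew form of this shape is
`J`-invariant and tames `J` (`IsUnitaryPair.skew_invariant_and_pos`).

Integrability: the Nijenhuis tensor is skew and complex antilinear in each argument, so it is
determined by its value on `(k₊, a)`. That value vanishes because shear-freeness gives `J[k±, a] =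
[k±, b]` (`map_mlieBracket_of_isShearFree`).

Smoothness of `J` is not assumed. It follows from the smooth unitary frames of
`exists_unitaryFrame`, in which the sign of `b = ±J a` is fixed by continuity of the orientation. -/

theorem natCast_le_infty (n : ℕ) : (n : WithTop ℕ∞) ≤ ∞ := by
  exact_mod_cast le_top

/-! ### Smooth vector fields and the commutator formula for Lie brackets -/

/-- Smoothness of a vector field at a point. -/
abbrev SmoothAt (X : VField M) (x : M) : Prop :=
  ContMDiffAt (𝓡 4) ((𝓡 4).prod 𝓘(ℝ, E4)) ∞ (fun y ↦ TotalSpace.mk' E4 y (X y)) x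

theorem SmoothAt.diffAt {X : VField M} {x : M} (hX : SmoothAt X x) : DiffAt X x :=
  ContMDiffAt.mdifferentiableAt hX (by simp)

theorem SmoothOn.smoothAt {X : VField M} {U : Set M} {x : M} (hX : SmoothOn X U)
    (hU : IsOpen U) (hx : x ∈ U) : SmoothAt X x :=
  ContMDiffOn.contMDiffAt hX (hU.mem_nhds hx)

theorem smoothOn_iff {X : VField M} {U : Set M} (hU : IsOpen U) :
    SmoothOn X U ↔ ∀ x ∈ U, SmoothAt X x :=
  ⟨fun h _ hx ↦ h.smoothAt hU hx, fun h x hx ↦ (h x hx).contMDiffWithinAt⟩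

theorem SmoothAt.mlieBracket {X Y : VField M} {x : M} (hX : SmoothAt X x) (hY : SmoothAt Y x) :
    SmoothAt (mlieBracket (𝓡 4) X Y) x :=
  have : IsManifold (𝓡 4) (minSmoothness ℝ 2) M :=
    .of_le (n := ∞) (by simpa using natCast_le_infty 2)
  have : IsManifold (𝓡 4) (minSmoothness ℝ 3) M :=
    .of_le (n := ∞) (by simpa using natCast_le_infty 3)
  have : IsManifold (𝓡 4) (((⊤ : ℕ∞) : WithTop ℕ∞) + 1) M := .of_le (n := ∞) (by simp)
  ContMDiffAt.mlieBracket_vectorField (m := ⊤) (n := ⊤) hX hY (by simp)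

theorem contMDiffAt_mvfderiv_apply {φ : M → ℝ} {X : VField M} {x : M}
    (hφ : ContMDiffAt (𝓡 4) 𝓘(ℝ) ∞ φ x) (hX : SmoothAt X x) :
    ContMDiffAt (𝓡 4) 𝓘(ℝ) ∞ (fun y ↦ mvfderiv (𝓡 4) φ y (X y)) x := by
  have h := hφ.mfderiv_const (m := ∞) (by simp)
  have h' := ContMDiffAt.clm_apply_of_inCoordinates (F₁ := E4) (F₂ := ℝ) (b₁ := id) (b₂ := φ)
    (ϕ := fun y ↦ mfderiv (𝓡 4) 𝓘(ℝ) φ y) (v := X) h hX hφ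
  rw [contMDiffAt_totalSpace] at h'
  simpa using! h'.2

/-- The pullback applies the inverse of the derivative of the inverse chart, so it cancels against
the chain rule. This moves directional derivatives into the chart, where the commutator formula is
Euclidean. -/
theorem mvfderiv_mpullbackWithin_extChartAt {φ : M → ℝ} {x : M} (V : VField M) {z : E4}
    (hz : z ∈ (extChartAt (𝓡 4) x).target)
    (hφ : MDifferentiableAt (𝓡 4) 𝓘(ℝ) φ ((extChartAt (𝓡 4) x).symm z)) :
    fderiv ℝ (φ ∘ (extChartAt (𝓡 4) x).symm) z
        (mpullbackWithin 𝓘(ℝ, E4) (𝓡 4) (extChartAt (𝓡 4) x).symm V (Set.range (𝓡 4)) z)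
      = mvfderiv (𝓡 4) φ ((extChartAt (𝓡 4) x).symm z) (V ((extChartAt (𝓡 4) x).symm z)) := by
  have : IsManifold (𝓡 4) 1 M := .of_le (n := ∞) (by simp)
  have h1 : MDifferentiableWithinAt 𝓘(ℝ, E4) (𝓡 4) (extChartAt (𝓡 4) x).symm
      (Set.range (𝓡 4)) z := mdifferentiableWithinAt_extChartAt_symm hz
  have h2 := isInvertible_mfderivWithin_extChartAt_symm (I := 𝓡 4) hz
  have hr : Set.range (𝓡 4) = Set.univ := by simp
  rw [hr] at h1 h2 ⊢
  rw [mdifferentiableWithinAt_univ] at h1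
  have h3 := mvfderiv_comp z hφ h1
  have h4 : fderiv ℝ (φ ∘ (extChartAt (𝓡 4) x).symm) z
      = mvfderiv 𝓘(ℝ, E4) (φ ∘ (extChartAt (𝓡 4) x).symm) z := by
    simp [mvfderiv, mfderiv_eq_fderiv]
    rfl
  rw [h4, h3, mpullbackWithin_apply]
  rw [mfderivWithin_univ] at h2 ⊢
  refine congrArg (mvfderiv (𝓡 4) φ ((extChartAt (𝓡 4) x).symm z)) ?_
  obtain ⟨e, he⟩ := h2
  rw [← he, ContinuousLinearMap.inverse_equiv]
  exact e.apply_symm_apply _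

/-- The derivative along a Lie bracket is the commutator of the derivatives. -/
theorem mvfderiv_mlieBracket {φ : M → ℝ} {V W : VField M} {x : M}
    (hφ : ContMDiffAt (𝓡 4) 𝓘(ℝ) ∞ φ x) (hV : SmoothAt V x) (hW : SmoothAt W x) :
    mvfderiv (𝓡 4) φ x (mlieBracket (𝓡 4) V W x)
      = mvfderiv (𝓡 4) (fun y ↦ mvfderiv (𝓡 4) φ y (W y)) x (V x)
        - mvfderiv (𝓡 4) (fun y ↦ mvfderiv (𝓡 4) φ y (V y)) x (W x) := by
  have : IsManifold (𝓡 4) 1 M := .of_le (n := ∞) (by simp)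
  have : IsManifold (𝓡 4) 2 M := .of_le (n := ∞) (natCast_le_infty 2)
  set c := extChartAt (𝓡 4) x with hc
  have hx : c.symm (c x) = x := extChartAt_to_inv x
  have hr : Set.range (𝓡 4) = Set.univ := by simp
  have hct : c x ∈ c.target := mem_extChartAt_target x
  set V' := mpullbackWithin 𝓘(ℝ, E4) (𝓡 4) c.symm V (Set.range (𝓡 4)) with hV'
  set W' := mpullbackWithin 𝓘(ℝ, E4) (𝓡 4) c.symm W (Set.range (𝓡 4)) with hW'
  set F : E4 → ℝ := φ ∘ c.symm with hF
  have key : ∀ {ψ : M → ℝ} (X : VField M), MDifferentiableAt (𝓡 4) 𝓘(ℝ) ψ x →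
      fderiv ℝ (ψ ∘ c.symm) (c x)
        (mpullbackWithin 𝓘(ℝ, E4) (𝓡 4) c.symm X (Set.range (𝓡 4)) (c x))
        = mvfderiv (𝓡 4) ψ x (X x) := by
    intro ψ X hψ
    rw [mvfderiv_mpullbackWithin_extChartAt X hct (by rwa [hx]), ← hc, hx]
  -- Equality near the point, not just at it, because these functions are differentiated once more.
  have hev : ∀ X : VField M, (fun z ↦ fderiv ℝ F z
        (mpullbackWithin 𝓘(ℝ, E4) (𝓡 4) c.symm X (Set.range (𝓡 4)) z))
      =ᶠ[𝓝 (c x)] (fun y ↦ mvfderiv (𝓡 4) φ y (X y)) ∘ c.symm := by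
    intro X
    have h1 : ∀ᶠ y in 𝓝 (c.symm (c x)), ContMDiffAt (𝓡 4) 𝓘(ℝ) 1 φ y := by
      rw [hx]
      exact (contMDiffAt_iff_contMDiffAt_nhds (by simp)).1 (hφ.of_le (natCast_le_infty 1))
    have h2 : ContinuousAt c.symm (c x) := continuousAt_extChartAt_symm x
    filter_upwards [h2.eventually h1, (isOpen_extChartAt_target x).mem_nhds hct] with z hz hzt
    exact mvfderiv_mpullbackWithin_extChartAt X hzt (hz.mdifferentiableAt (by simp))
  have hpull : ∀ {X : VField M}, SmoothAt X x → ContDiffAt ℝ 1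
      (mpullbackWithin 𝓘(ℝ, E4) (𝓡 4) c.symm X (Set.range (𝓡 4))) (c x) := by
    intro X hX
    have h := contMDiffWithinAt_mpullbackWithin_extChartAt_symm (I := 𝓡 4) (m := 1) (n := 2)
      (s := Set.univ) (x := x) (V := X) (ContMDiffAt.of_le hX (by simp)).contMDiffWithinAt
      uniqueMDiffOn_univ (Set.mem_univ _) (by norm_num)
    rw [Set.preimage_univ, Set.inter_univ] at h
    exact (contMDiffWithinAt_vectorSpace_iff_contDiffWithinAt.1 h).contDiffAt
      ((isOpen_extChartAt_target x).mem_nhds hct)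
  -- The tangent space at `x` is identified with `E4` by the preferred chart, whose derivative at
  -- `x` is then the identity; so the bracket at `x` is the Euclidean bracket in that chart.
  have h0 : (mfderiv (𝓡 4) 𝓘(ℝ, E4) (extChartAt (𝓡 4) x) x).inverse
      = ContinuousLinearMap.id ℝ E4 := by
    rw [mfderiv_extChartAt_self]
    exact ContinuousLinearMap.inverse_id
  have hbr : mlieBracket (𝓡 4) V W x = lieBracket ℝ V' W' (c x) := by
    rw [← mlieBracketWithin_univ, mlieBracketWithin_apply, h0]
    exact (congrArg (fun s ↦ lieBracketWithin ℝ V' W' s (c x))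
      (by simp : c.symm ⁻¹' Set.univ ∩ Set.range (𝓡 4) = Set.univ)).trans
      (congrFun lieBracketWithin_univ _)
  have hd : mvfderiv (𝓡 4) φ x (mlieBracket (𝓡 4) V W x)
      = fderiv ℝ F (c x) (lieBracket ℝ V' W' (c x)) := by
    rw [hbr, MDifferentiableAt.mvfderiv (hφ.mdifferentiableAt (by simp)), hr, fderivWithin_univ]
    rfl
  have hFs : ContDiffAt ℝ 2 F (c x) := by
    have h1 : ContMDiffAt 𝓘(ℝ, E4) (𝓡 4) 2 c.symm (c x) := by
      have h := contMDiffWithinAt_extChartAt_symm_range_self (n := 2) (I := 𝓡 4) x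
      rwa [hr, contMDiffWithinAt_univ] at h
    have h2 : ContMDiffAt 𝓘(ℝ, E4) 𝓘(ℝ) 2 F (c x) :=
      ContMDiffAt.comp_of_eq (g := φ) (hφ.of_le (natCast_le_infty 2)) h1 hx
    exact h2.contDiffAt
  -- Symmetry of the second derivative of `F` removes the second-order terms of the commutator.
  rw [hd, fderiv_apply_lieBracket_of_isSymmSndFDerivAt hFs (hFs.isSymmSndFDerivAt (by simp))
    ((hpull hW).differentiableAt (by simp)) ((hpull hV).differentiableAt (by simp)),
    (hev W).fderiv_eq, (hev V).fderiv_eq,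
    key V ((contMDiffAt_mvfderiv_apply hφ hW).mdifferentiableAt (by simp)),
    key W ((contMDiffAt_mvfderiv_apply hφ hV).mdifferentiableAt (by simp))]

/-! ### Smoothness of bundle homomorphisms, tested on vector fields -/

section Hom
variable {F : Type*} [NormedAddCommGroup F] [NormedSpace ℝ F]
  {V : M → Type*} [TopologicalSpace (TotalSpace F V)] [∀ x, AddCommGroup (V x)]
  [∀ x, Module ℝ (V x)] [∀ x, TopologicalSpace (V x)] [FiberBundle F V] [VectorBundle ℝ F V]
  [∀ x, IsTopologicalAddGroup (V x)] [∀ x, ContinuousSMul ℝ (V x)]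

/-- In finite dimension `φ` is a finite sum of coordinate functionals times the values of `φ` on a
basis. -/
theorem contMDiffAt_clm_of_apply {φ : M → E4 →L[ℝ] F} {x : M}
    (h : ∀ v, ContMDiffAt (𝓡 4) 𝓘(ℝ, F) ∞ (fun y ↦ φ y v) x) :
    ContMDiffAt (𝓡 4) 𝓘(ℝ, E4 →L[ℝ] F) ∞ φ x := by
  have e : φ = fun y ↦ ∑ i : Fin 4,
      ContinuousLinearMap.smulRightL ℝ E4 F (EuclideanSpace.proj i)
        (φ y (EuclideanSpace.basisFun (Fin 4) ℝ i)) := by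
    funext y
    ext v
    conv_lhs => rw [← (EuclideanSpace.basisFun (Fin 4) ℝ).sum_repr v]
    simp
  rw [e]
  refine contMDiffAt_finsetSum fun i _ ↦ ?_
  exact (ContinuousLinearMap.contMDiff _).contMDiffAt.comp x (h _)

/-- A section of a bundle of homomorphisms out of the tangent bundle is smooth if it maps smooth
vector fields to smooth sections. -/
theorem contMDiffAt_hom_of_apply {A : (x : M) → TangentSpace (𝓡 4) x →L[ℝ] V x} {x : M}
    (h : ∀ X : VField M, SmoothAt X x →
      ContMDiffAt (𝓡 4) ((𝓡 4).prod 𝓘(ℝ, F)) ∞ (fun y ↦ TotalSpace.mk' F y (A y (X y))) x) :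
    ContMDiffAt (𝓡 4) ((𝓡 4).prod 𝓘(ℝ, E4 →L[ℝ] F)) ∞
      (fun y ↦ TotalSpace.mk' (E4 →L[ℝ] F) (E := fun y : M ↦ TangentSpace (𝓡 4) y →L[ℝ] V y)
        y (A y)) x := by
  rw [contMDiffAt_hom_bundle]
  refine ⟨contMDiffAt_id, contMDiffAt_clm_of_apply fun v ↦ ?_⟩
  set e := trivializationAt E4 (TangentSpace (𝓡 4) : M → Type _) x with he
  have hx : x ∈ e.baseSet := mem_baseSet_trivializationAt ..
  -- The test fields are those that are constant in the trivialization around `x`.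
  have hX : SmoothAt (fun y ↦ e.symm y v) x := by
    rw [SmoothAt, contMDiffAt_totalSpace]
    refine ⟨contMDiffAt_id, (contMDiffAt_const (c := v)).congr_of_eventuallyEq ?_⟩
    filter_upwards [e.open_baseSet.mem_nhds hx] with y hy
    simp [← he, e.apply_mk_symm hy]
  have h' := (contMDiffAt_totalSpace.1 (h _ hX)).2
  refine h'.congr_of_eventuallyEq ?_
  have hx' : x ∈ (trivializationAt F V x).baseSet := mem_baseSet_trivializationAt ..
  filter_upwards [e.open_baseSet.mem_nhds hx,
    (trivializationAt F V x).open_baseSet.mem_nhds hx'] with y hy hy'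
  rw [ContinuousLinearMap.inCoordinates_eq hy hy']
  simp [← he, Trivialization.continuousLinearEquivAt_apply]
end Hom

/-! ### The exterior derivative of a one-form, and its closedness -/

section OneForm

/-- Smoothness of a `1`-form. -/
abbrev SmoothForm (α : (x : M) → TangentSpace (𝓡 4) x →L[ℝ] ℝ) : Prop :=
  ContMDiff (𝓡 4) ((𝓡 4).prod 𝓘(ℝ, E4 →L[ℝ] ℝ)) ∞
    (fun x ↦ TotalSpace.mk' (E4 →L[ℝ] ℝ) (E := fun x : M ↦ TangentSpace (𝓡 4) x →L[ℝ] ℝ) x (α x))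

variable {α : (x : M) → TangentSpace (𝓡 4) x →L[ℝ] ℝ} {X Y Z : VField M} {x : M}

theorem SmoothForm.mdifferentiableAt_apply (hα : SmoothForm α) (hX : DiffAt X x) :
    MDifferentiableAt (𝓡 4) 𝓘(ℝ) (fun y ↦ α y (X y)) x := by
  have h : MDifferentiableAt (𝓡 4) ((𝓡 4).prod 𝓘(ℝ))
      (fun m ↦ TotalSpace.mk' ℝ (E := Bundle.Trivial M ℝ) m (α m (X m))) x := by
    apply MDifferentiableAt.clm_bundle_apply (F₁ := E4)
    · exact hα.mdifferentiableAt (by simp)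
    · exact hX
  simp only [mdifferentiableAt_totalSpace] at h
  exact h.2

theorem SmoothForm.contMDiffAt_apply (hα : SmoothForm α) (hX : SmoothAt X x) :
    ContMDiffAt (𝓡 4) 𝓘(ℝ) ∞ (fun y ↦ α y (X y)) x := by
  have h : ContMDiffAt (𝓡 4) ((𝓡 4).prod 𝓘(ℝ)) ∞
      (fun m ↦ TotalSpace.mk' ℝ (E := Bundle.Trivial M ℝ) m (α m (X m))) x := by
    apply ContMDiffAt.clm_bundle_apply (F₁ := E4)
    · exact hα.contMDiffAt
    · exact hX
  simp only [contMDiffAt_totalSpace] at h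
  exact h.2

theorem dOneForm_swap (α : (x : M) → TangentSpace (𝓡 4) x →L[ℝ] ℝ) (X Y : VField M) (x : M) :
    dOneForm α X Y x = -dOneForm α Y X x := by
  rw [dOneForm, dOneForm, mlieBracket_swap_apply, map_neg]
  ring

/-- The derivative of `f` enters once through the product rule and once through the bracket, with
opposite signs. -/
theorem SmoothForm.tensorialAt_left (hα : SmoothForm α) (Y : VField M) :
    TensorialAt (𝓡 4) E4 (dOneForm α · Y x) x where
  smul {f X} hf hX := by
    have h := mvfderiv_fun_mul hf (hα.mdifferentiableAt_apply hX)
    simp only [dOneForm, Pi.smul_apply', map_smul, smul_eq_mul, h, smul_apply, add_apply,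
      mlieBracket_smul_left hf hX, map_add, neg_smul, map_neg]
    ring
  add {X X'} hX hX' := by
    have h := mvfderiv_fun_add (hα.mdifferentiableAt_apply hX) (hα.mdifferentiableAt_apply hX')
    simp only [dOneForm, Pi.add_apply, map_add, h, add_apply, mlieBracket_add_left hX hX']
    ring

theorem SmoothForm.tensorialAt_right (hα : SmoothForm α) (X : VField M) :
    TensorialAt (𝓡 4) E4 (dOneForm α X · x) x where
  smul {f Y} hf hY := by
    rw [dOneForm_swap, (hα.tensorialAt_left X).smul hf hY, dOneForm_swap α X]
    simp
  add {Y Y'} hY hY' := by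
    rw [dOneForm_swap, (hα.tensorialAt_left X).add hY hY', dOneForm_swap α X,
      dOneForm_swap α X Y']
    ring

/-- The exterior derivative of a smooth `1`-form at a point, as a bilinear map. -/
def dOneFormHom (α : (x : M) → TangentSpace (𝓡 4) x →L[ℝ] ℝ) (hα : SmoothForm α) (x : M) :
    TangentSpace (𝓡 4) x →L[ℝ] TangentSpace (𝓡 4) x →L[ℝ] ℝ :=
  TensorialAt.mkHom₂ (I := 𝓡 4) (F := E4) (F' := E4) (fun X Y ↦ dOneForm α X Y x) x
    (fun Y _ ↦ hα.tensorialAt_left Y) (fun X _ ↦ hα.tensorialAt_right X)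

theorem dOneFormHom_apply (hα : SmoothForm α) (hX : DiffAt X x) (hY : DiffAt Y x) :
    dOneFormHom α hα x (X x) (Y x) = dOneForm α X Y x :=
  TensorialAt.mkHom₂_apply (I := 𝓡 4) (F := E4) (F' := E4) _ _ hX hY

/-- `dOneFormHom` evaluates on the same canonical extensions as `dOneFormAt`, so the two agree
definitionally. -/
theorem dOneFormAt_apply (hα : SmoothForm α) (hX : DiffAt X x) (hY : DiffAt Y x) :
    dOneFormAt α x (X x) (Y x) = dOneForm α X Y x :=
  dOneFormHom_apply hα hX hY

theorem dOneFormHom_swap (hα : SmoothForm α) (v w : TangentSpace (𝓡 4) x) :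
    dOneFormHom α hα x v w = -dOneFormHom α hα x w v :=
  dOneForm_swap ..

theorem SmoothForm.contMDiffAt_dOneForm (hα : SmoothForm α) (hX : SmoothAt X x)
    (hY : SmoothAt Y x) : ContMDiffAt (𝓡 4) 𝓘(ℝ) ∞ (dOneForm α X Y) x :=
  ((contMDiffAt_mvfderiv_apply (hα.contMDiffAt_apply hY) hX).sub
    (contMDiffAt_mvfderiv_apply (hα.contMDiffAt_apply hX) hY)).sub
    (hα.contMDiffAt_apply (hX.mlieBracket hY))

theorem dTwoForm_congr {θ θ' : (x : M) → TangentSpace (𝓡 4) x → TangentSpace (𝓡 4) x → ℝ}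
    (h : ∀ᶠ y in 𝓝 x, θ y = θ' y) : dTwoForm θ X Y Z x = dTwoForm θ' X Y Z x := by
  have e : ∀ X Y : VField M, mvfderiv (𝓡 4) (fun y ↦ θ y (X y) (Y y)) x
      = mvfderiv (𝓡 4) (fun y ↦ θ' y (X y) (Y y)) x := fun X Y ↦ by
    have h' : (fun y ↦ θ y (X y) (Y y)) =ᶠ[𝓝 x] fun y ↦ θ' y (X y) (Y y) :=
      h.mono fun y hy ↦ by simp only [hy]
    rw [mvfderiv, mvfderiv, h'.mfderiv_eq, h'.eq_of_nhds]
  simp only [dTwoForm, e, h.self_of_nhds]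

/-- The second derivatives of the functions `α(X)`, `α(Y)`, `α(Z)` cancel by the commutator formula,
and the iterated brackets cancel by the Jacobi identity. Openness of `U` lets `dOneFormAt` be
replaced by `dOneForm` before differentiating. -/
theorem dTwoForm_dOneForm (hα : SmoothForm α) {U : Set M} (hU : IsOpen U) (hX : SmoothOn X U)
    (hY : SmoothOn Y U) (hZ : SmoothOn Z U) (hx : x ∈ U) :
    dTwoForm (dOneFormAt α) X Y Z x = 0 := by
  have : IsManifold (𝓡 4) (minSmoothness ℝ 3) M :=
    .of_le (n := ∞) (by simpa using natCast_le_infty 3)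
  have e : ∀ {X Y : VField M}, SmoothOn X U → SmoothOn Y U → ∀ v,
      mvfderiv (𝓡 4) (fun y ↦ dOneFormAt α y (X y) (Y y)) x v
      = mvfderiv (𝓡 4) (fun y ↦ mvfderiv (𝓡 4) (fun y ↦ α y (Y y)) y (X y)) x v
        - mvfderiv (𝓡 4) (fun y ↦ mvfderiv (𝓡 4) (fun y ↦ α y (X y)) y (Y y)) x v
        - mvfderiv (𝓡 4) (fun y ↦ α y (mlieBracket (𝓡 4) X Y y)) x v := by
    intro X Y hX hY v
    have h' : (fun y ↦ dOneFormAt α y (X y) (Y y)) =ᶠ[𝓝 x] dOneForm α X Y := by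
      filter_upwards [hU.mem_nhds hx] with y hy
      exact dOneFormAt_apply hα (hX.smoothAt hU hy).diffAt (hY.smoothAt hU hy).diffAt
    have hX := hX.smoothAt hU hx
    have hY := hY.smoothAt hU hx
    have d1 := (contMDiffAt_mvfderiv_apply (hα.contMDiffAt_apply hY) hX).mdifferentiableAt
      (by simp)
    have d2 := (contMDiffAt_mvfderiv_apply (hα.contMDiffAt_apply hX) hY).mdifferentiableAt
      (by simp)
    have d12 : MDifferentiableAt (𝓡 4) 𝓘(ℝ) (fun y ↦
        mvfderiv (𝓡 4) (fun y ↦ α y (Y y)) y (X y)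
          - mvfderiv (𝓡 4) (fun y ↦ α y (X y)) y (Y y)) x := d1.sub d2
    have d3 := (hα.contMDiffAt_apply (hX.mlieBracket hY)).mdifferentiableAt (by simp)
    have h4 : mvfderiv (𝓡 4) (fun y ↦ dOneFormAt α y (X y) (Y y)) x
        = mvfderiv (𝓡 4) (dOneForm α X Y) x := by
      rw [mvfderiv, mvfderiv, h'.mfderiv_eq, h'.eq_of_nhds]
    rw [h4]
    unfold dOneForm
    rw [mvfderiv_fun_sub d12 d3, mvfderiv_fun_sub d1 d2]
    rfl
  have hX' := hX.smoothAt hU hx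
  have hY' := hY.smoothAt hU hx
  have hZ' := hZ.smoothAt hU hx
  have J := leibniz_identity_mlieBracket_apply (I := 𝓡 4) (U := X) (V := Y) (W := Z) (x := x)
    (ContMDiffAt.of_le hX' (by simpa using natCast_le_infty 2))
    (ContMDiffAt.of_le hY' (by simpa using natCast_le_infty 2))
    (ContMDiffAt.of_le hZ' (by simpa using natCast_le_infty 2))
  have J' := congrArg (α x) J
  rw [map_add, mlieBracket_swap_apply, mlieBracket_swap_apply (V := Y), map_neg, map_neg] at J'
  rw [dTwoForm, e hX hY, e hX hZ, e hY hZ,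
    dOneFormAt_apply hα (hX'.mlieBracket hY').diffAt hZ'.diffAt,
    dOneFormAt_apply hα (hX'.mlieBracket hZ').diffAt hY'.diffAt,
    dOneFormAt_apply hα (hY'.mlieBracket hZ').diffAt hX'.diffAt]
  unfold dOneForm
  rw [mvfderiv_mlieBracket (hα.contMDiffAt_apply hZ') hX' hY',
    mvfderiv_mlieBracket (hα.contMDiffAt_apply hY') hX' hZ',
    mvfderiv_mlieBracket (hα.contMDiffAt_apply hX') hY' hZ']
  linear_combination -J'

end OneForm

/-! ### The Nijenhuis tensor is a tensor -/

section Nijenhuis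
variable {J : (x : M) → TangentSpace (𝓡 4) x →L[ℝ] TangentSpace (𝓡 4) x} {X Y : VField M} {x : M}

theorem nijenhuis_swap (J : (x : M) → TangentSpace (𝓡 4) x →L[ℝ] TangentSpace (𝓡 4) x)
    (X Y : VField M) (x : M) : nijenhuis J X Y x = -nijenhuis J Y X x := by
  simp only [nijenhuis]
  rw [mlieBracket_swap_apply, mlieBracket_swap_apply (W := Y),
    mlieBracket_swap_apply (V := X) (W := fun y ↦ J y (Y y)),
    mlieBracket_swap_apply (V := X) (W := Y)]
  simp only [map_neg]
  abel

/-- Differentiability at a point of a field of endomorphisms of the tangent spaces. -/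
abbrev DiffEndAt (J : (x : M) → TangentSpace (𝓡 4) x →L[ℝ] TangentSpace (𝓡 4) x) (x : M) : Prop :=
  MDifferentiableAt (𝓡 4) ((𝓡 4).prod 𝓘(ℝ, E4 →L[ℝ] E4)) (fun x ↦ TotalSpace.mk' (E4 →L[ℝ] E4)
      (E := fun x : M ↦ TangentSpace (𝓡 4) x →L[ℝ] TangentSpace (𝓡 4) x) x (J x)) x

theorem DiffEndAt.apply (hJ : DiffEndAt J x) (hX : DiffAt X x) :
    DiffAt (fun y ↦ J y (X y)) x :=
  MDifferentiableAt.clm_bundle_apply (F₁ := E4) (F₂ := E4) hJ hX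

/-- The derivatives of `f` along `J Y` cancel directly; those along `Y` cancel because `J² = -1`. -/
theorem tensorialAt_nijenhuis_left (hJ : DiffEndAt J x) (hsq : ∀ v, J x (J x v) = -v)
    (Y : VField M) : TensorialAt (𝓡 4) E4 (nijenhuis J · Y x) x where
  smul {f X} hf hX := by
    have e : (fun y ↦ J y ((f • X) y)) = f • fun y ↦ J y (X y) := by
      funext y
      simp
    simp only [nijenhuis, e]
    rw [mlieBracket_smul_left hf hX, mlieBracket_smul_left hf hX,
      mlieBracket_smul_left hf (hJ.apply hX), mlieBracket_smul_left hf (hJ.apply hX)]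
    simp only [map_add, map_smul, hsq, neg_smul, map_neg, smul_neg, smul_sub]
    abel
  add {X X'} hX hX' := by
    have e : (fun y ↦ J y ((X + X') y)) = (fun y ↦ J y (X y)) + fun y ↦ J y (X' y) := by
      funext y
      simp
    simp only [nijenhuis, e]
    rw [mlieBracket_add_left hX hX', mlieBracket_add_left hX hX',
      mlieBracket_add_left (hJ.apply hX) (hJ.apply hX'),
      mlieBracket_add_left (hJ.apply hX) (hJ.apply hX')]
    simp only [map_add]
    abel

theorem tensorialAt_nijenhuis_right (hJ : DiffEndAt J x) (hsq : ∀ v, J x (J x v) = -v)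
    (X : VField M) : TensorialAt (𝓡 4) E4 (nijenhuis J X · x) x where
  smul {f Y} hf hY := by
    rw [nijenhuis_swap, (tensorialAt_nijenhuis_left hJ hsq X).smul hf hY, nijenhuis_swap J X]
    simp
  add {Y Y'} hY hY' := by
    rw [nijenhuis_swap, (tensorialAt_nijenhuis_left hJ hsq X).add hY hY', nijenhuis_swap J X,
      nijenhuis_swap J X Y']
    abel

/-- The Nijenhuis tensor at a point, as a bilinear map. -/
def nijenhuisHom (hJ : DiffEndAt J x) (hsq : ∀ v, J x (J x v) = -v) :
    TangentSpace (𝓡 4) x →L[ℝ] TangentSpace (𝓡 4) x →L[ℝ] TangentSpace (𝓡 4) x :=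
  TensorialAt.mkHom₂ (I := 𝓡 4) (F := E4) (F' := E4) (fun X Y ↦ nijenhuis J X Y x) x
    (fun Y _ ↦ tensorialAt_nijenhuis_left hJ hsq Y)
    (fun X _ ↦ tensorialAt_nijenhuis_right hJ hsq X)

theorem nijenhuisHom_apply (hJ : DiffEndAt J x) (hsq : ∀ v, J x (J x v) = -v)
    (hX : DiffAt X x) (hY : DiffAt Y x) :
    nijenhuisHom hJ hsq (X x) (Y x) = nijenhuis J X Y x :=
  TensorialAt.mkHom₂_apply (I := 𝓡 4) (F := E4) (F' := E4) _ _ hX hY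

end Nijenhuis

/-! ### Null pairs and the horizontal bundle -/

namespace SemiRiemannianMetric
variable {g : SemiRiemannianMetric M} {kp km : VField M} {x : M}

theorem contMDiffAt_inner (g : SemiRiemannianMetric M) {X Y : VField M}
    (hX : SmoothAt X x) (hY : SmoothAt Y x) :
    ContMDiffAt (𝓡 4) 𝓘(ℝ) ∞ (fun y ↦ g.inner y (X y) (Y y)) x := by
  have h : ContMDiffAt (𝓡 4) ((𝓡 4).prod 𝓘(ℝ)) ∞
      (fun m ↦ TotalSpace.mk' ℝ (E := Bundle.Trivial M ℝ) m (g.inner m (X m) (Y m))) x := by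
    apply ContMDiffAt.clm_bundle_apply₂ (F₁ := E4) (F₂ := E4)
    · exact g.contMDiff.contMDiffAt
    · exact hX
    · exact hY
  simp only [contMDiffAt_totalSpace] at h
  exact h.2

theorem mem_horizontal {v : TangentSpace (𝓡 4) x} :
    v ∈ g.horizontal kp km x ↔ g.inner x (kp x) v = 0 ∧ g.inner x (km x) v = 0 := by
  simp [horizontal]

/-- A pair of smooth null vector fields with negative scalar product. -/
structure IsNullPair (g : SemiRiemannianMetric M) (kp km : VField M) : Prop where
  smooth_left : SmoothOn kp Set.univ
  smooth_right : SmoothOn km Set.univ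
  left_null : ∀ x, g.inner x (kp x) (kp x) = 0
  right_null : ∀ x, g.inner x (km x) (km x) = 0
  neg : ∀ x, g.inner x (kp x) (km x) < 0

/-- The horizontal part of a vector field with respect to a null pair. -/
def horizontalPart (g : SemiRiemannianMetric M) (kp km X : VField M) : VField M :=
  X - (fun y ↦ g.inner y (km y) (X y) / g.inner y (kp y) (km y)) • kp
    - (fun y ↦ g.inner y (kp y) (X y) / g.inner y (kp y) (km y)) • km

theorem horizontalPart_eq {X : VField M} (hX : X x ∈ g.horizontal kp km x) :
    g.horizontalPart kp km X x = X x := by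
  rw [mem_horizontal] at hX
  simp [horizontalPart, hX.1, hX.2]

/-- Near a point, a horizontal smooth vector field with nonzero value can be normalized. -/
theorem exists_unit {Y : VField M} (hY : ∀ᶠ y in 𝓝 x, SmoothAt Y y)
    (hpos : 0 < g.inner x (Y x) (Y x)) :
    ∃ a : VField M, (∃ c : M → ℝ, a = c • Y ∧ 0 < c x) ∧
      (∀ᶠ y in 𝓝 x, SmoothAt a y) ∧ ∀ᶠ y in 𝓝 x, g.inner y (a y) (a y) = 1 := by
  have hc : ∀ᶠ y in 𝓝 x, 0 < g.inner y (Y y) (Y y) :=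
    (g.contMDiffAt_inner hY.self_of_nhds hY.self_of_nhds).continuousAt.eventually
      (lt_mem_nhds hpos)
  refine ⟨(fun y ↦ (√(g.inner y (Y y) (Y y)))⁻¹) • Y, ⟨_, rfl, by positivity⟩, ?_, ?_⟩
  · filter_upwards [hY, hc] with y hy hpy
    have h1 : ContMDiffAt (𝓡 4) 𝓘(ℝ) ∞ (fun y ↦ √(g.inner y (Y y) (Y y))) y :=
      (Real.contDiffAt_sqrt hpy.ne').contMDiffAt.comp y (g.contMDiffAt_inner hy hy)
    exact (h1.inv₀ (by positivity)).smul_section hy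
  · filter_upwards [hc] with y hpy
    simp only [Pi.smul_apply', map_smul, smul_apply, smul_eq_mul]
    rw [← mul_assoc, ← mul_inv, Real.mul_self_sqrt hpy.le, inv_mul_cancel₀ hpy.ne']

namespace IsNullPair
variable (h : g.IsNullPair kp km)
include h

theorem smoothAt_left (x : M) : SmoothAt kp x := h.smooth_left.smoothAt isOpen_univ trivial

theorem smoothAt_right (x : M) : SmoothAt km x := h.smooth_right.smoothAt isOpen_univ trivial

theorem smoothAt_horizontalPart {X : VField M} (hX : SmoothAt X x) :
    SmoothAt (g.horizontalPart kp km X) x := by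
  have hG := g.contMDiffAt_inner (h.smoothAt_left x) (h.smoothAt_right x)
  exact ((hX.sub_section (((g.contMDiffAt_inner (h.smoothAt_right x) hX).div₀ hG
    (h.neg x).ne).smul_section (h.smoothAt_left x))).sub_section
    (((g.contMDiffAt_inner (h.smoothAt_left x) hX).div₀ hG
    (h.neg x).ne).smul_section (h.smoothAt_right x)))

theorem horizontalPart_mem (X : VField M) (x : M) :
    g.horizontalPart kp km X x ∈ g.horizontal kp km x := by
  have := (h.neg x).ne
  rw [mem_horizontal]
  simp only [horizontalPart, Pi.sub_apply, Pi.smul_apply', map_sub, map_smul, h.left_null,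
    h.right_null, smul_eq_mul, g.symm x (km x) (kp x)]
  constructor <;> field_simp <;> ring

theorem exists_horizontal_ne_zero (x : M) : ∃ v ∈ g.horizontal kp km x, v ≠ 0 := by
  by_contra! H
  have hs : (⊤ : Submodule ℝ (TangentSpace (𝓡 4) x)) ≤ Submodule.span ℝ {kp x, km x} := by
    intro v _
    have h0 := H _ (h.horizontalPart_mem (FiberBundle.extend E4 v) x)
    simp only [horizontalPart, Pi.sub_apply, Pi.smul_apply', FiberBundle.extend_apply_self] at h0
    rw [sub_sub, sub_eq_zero] at h0
    rw [h0]
    exact Submodule.mem_span_pair.2 ⟨_, _, rfl⟩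
  have h1 := Submodule.finrank_mono hs
  have h2 : Module.finrank ℝ (Submodule.span ℝ {kp x, km x}) ≤ 2 := by
    classical
    have := finrank_span_finset_le_card (R := ℝ) ({kp x, km x} : Finset (TangentSpace (𝓡 4) x))
    rw [Finset.coe_pair] at this
    exact this.trans Finset.card_le_two
  have h3 : Module.finrank ℝ (⊤ : Submodule ℝ (TangentSpace (𝓡 4) x)) = 4 := by
    rw [finrank_top]
    exact finrank_euclideanSpace_fin
  omega

end IsNullPair
end SemiRiemannianMetric

theorem eventually_smoothAt_extend {x : M} (v : TangentSpace (𝓡 4) x) :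
    ∀ᶠ y in 𝓝 x, SmoothAt (FiberBundle.extend E4 v) y := by
  set e := trivializationAt E4 (TangentSpace (𝓡 4) : M → Type _) x with he
  have hx : x ∈ e.baseSet := mem_baseSet_trivializationAt ..
  filter_upwards [e.open_baseSet.mem_nhds hx] with y hy
  have h := (e.contMDiffOn_section_baseSet_iff (IB := 𝓡 4) (n := ∞)
    (s := FiberBundle.extend E4 v)).2 ((contMDiffOn_const (c := (e ⟨x, v⟩).2)).congr fun z hz ↦ by
      simp [FiberBundle.extend, ← he, e.apply_mk_symm hz])
  exact h.contMDiffAt (e.open_baseSet.mem_nhds hy)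

/-! ### Comparing orientations at nearby points -/

section Orientation

/-- The determinant of four tangent vectors in the trivialization around `x`. -/
def trivDet (x y : M) : (TangentSpace (𝓡 4) y) [⋀^Fin 4]→ₗ[ℝ] ℝ :=
  (EuclideanSpace.basisFun (Fin 4) ℝ).toBasis.det.compLinearMap
    ((trivializationAt E4 (TangentSpace (𝓡 4) : M → Type _) x).linearMapAt ℝ y)

/-- Makes the sign of the determinant of a smooth frame locally constant, which carries an
orientation from `x` to nearby points. -/
theorem continuousAt_trivDet {X : Fin 4 → VField M} {x : M} (hX : ∀ i, SmoothAt (X i) x) :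
    ContinuousAt (fun y ↦ trivDet x y fun i ↦ X i y) x := by
  set e := trivializationAt E4 (TangentSpace (𝓡 4) : M → Type _) x with he
  have hx : x ∈ e.baseSet := mem_baseSet_trivializationAt ..
  have h1 : ∀ i, ContinuousAt (fun y ↦ (e ⟨y, X i y⟩).2) x :=
    fun i ↦ (contMDiffAt_totalSpace.1 (hX i)).2.continuousAt
  have h2 : ContinuousAt (fun y ↦ Matrix.det (Matrix.of fun i j ↦ (e ⟨y, X j y⟩).2 i)) x := by
    refine ContinuousAt.comp (g := Matrix.det) (continuous_id.matrix_det.continuousAt) ?_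
    refine continuousAt_pi.2 fun i ↦ continuousAt_pi.2 fun j ↦ ?_
    exact ((EuclideanSpace.proj (𝕜 := ℝ) i).continuous.continuousAt).comp (h1 j)
  refine h2.congr ?_
  filter_upwards [e.open_baseSet.mem_nhds hx] with y hy
  simp only [trivDet, AlternatingMap.compLinearMap_apply, Module.Basis.det_apply]
  congr 1
  ext i j
  simp [Module.Basis.toMatrix_apply, ← he, e.linearMapAt_apply, hy]

/-- `trivDet x y` is a multiple of `b.det`, nonzero because the trivialization is an isomorphism
over its base set. Hence its values on `b` and `b'` have the same sign exactly when `b.det b'` is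
positive. -/
theorem trivDet_mul_pos {x y : M}
    (hy : y ∈ (trivializationAt E4 (TangentSpace (𝓡 4) : M → Type _) x).baseSet)
    {b b' : Module.Basis (Fin 4) ℝ (TangentSpace (𝓡 4) y)} (h : b.orientation = b'.orientation) :
    0 < trivDet x y b' * trivDet x y b := by
  have h1 := congrArg (fun A ↦ A b') ((trivDet x y).eq_smul_basis_det b)
  have h2 : trivDet x y b ≠ 0 := by
    have h3 := (EuclideanSpace.basisFun (Fin 4) ℝ).toBasis.isUnit_det
      (b.map (Trivialization.linearEquivAt ℝ _ y hy))
    refine (congrArg (EuclideanSpace.basisFun (Fin 4) ℝ).toBasis.det ?_).trans_ne h3.ne_zero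
    funext i
    simp only [Trivialization.linearMapAt_apply, if_pos hy, Module.Basis.map_apply,
      Trivialization.linearEquivAt_apply]
  have h3 := (b.orientation_eq_iff_det_pos b').1 h
  simp only [AlternatingMap.smul_apply, smul_eq_mul] at h1
  rw [h1]
  have := mul_self_pos.2 h2
  nlinarith [mul_pos this h3]

end Orientation

/-! ### Unitary frames and the smoothness of `J` -/

namespace SemiRiemannianMetric
variable {g : SemiRiemannianMetric M} {o : TangentOrientation M} {kp km : VField M} {x : M}
  {J : (x : M) → TangentSpace (𝓡 4) x →L[ℝ] TangentSpace (𝓡 4) x}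

/-- `a` is a horizontal unit vector and `b = J a`. -/
structure IsUnitaryPair (g : SemiRiemannianMetric M) (kp km : VField M)
    (J : (x : M) → TangentSpace (𝓡 4) x →L[ℝ] TangentSpace (𝓡 4) x) (x : M)
    (a b : TangentSpace (𝓡 4) x) : Prop where
  mem : a ∈ g.horizontal kp km x
  unit : g.inner x a a = 1
  map : J x a = b

namespace IsUnitaryPair
variable {a b : TangentSpace (𝓡 4) x} (h : g.IsUnitaryPair kp km J x a b)
  (hJ : g.IsAdmissibleAlmostComplex o kp km J)
include h hJ

theorem map_right : J x b = -a := by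
  rw [← h.map, hJ.sq_horizontal x a h.mem]

theorem right_mem : b ∈ g.horizontal kp km x :=
  h.map ▸ hJ.map_horizontal x a h.mem

theorem right_unit : g.inner x b b = 1 := by
  rw [← h.map, hJ.isometry_horizontal x a h.mem a h.mem, h.unit]

/-- The isometry property on `a` and `b = J a` gives `g(b, -a) = g(a, b)`. -/
theorem orthogonal : g.inner x a b = 0 := by
  have h1 := hJ.isometry_horizontal x a h.mem b (h.right_mem hJ)
  rw [h.map, h.map_right hJ, map_neg, g.symm] at h1
  linarith

theorem isOrientedFrame : g.IsOrientedFrame o kp km x a b where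
  left_mem := h.mem
  right_mem := h.right_mem hJ
  left_unit := h.unit
  right_unit := h.right_unit hJ
  orthogonal := h.orthogonal hJ
  oriented := h.map ▸ hJ.oriented_horizontal x a h.mem (by
    rintro rfl
    simpa using h.unit)

/-- The oriented frame is a basis. Since `k±` are null, the coefficient of `k₊` is found by pairing
with `k₋`, and conversely. -/
theorem eq_sum (hk : g.IsNullPair kp km) (v : TangentSpace (𝓡 4) x) :
    v = (g.inner x v (km x) / g.inner x (kp x) (km x)) • kp x
      + (g.inner x v (kp x) / g.inner x (kp x) (km x)) • km x
      + g.inner x v a • a + g.inner x v b • b := by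
  obtain ⟨B, hB, -⟩ := (h.isOrientedFrame hJ).oriented
  have hv := B.sum_repr v
  simp only [hB, Fin.sum_univ_four, Matrix.cons_val] at hv
  have hG := (hk.neg x).ne
  have ha := mem_horizontal.1 h.mem
  have hb := mem_horizontal.1 (h.right_mem hJ)
  have h1 := h.unit
  have h2 := h.right_unit hJ
  have h3 := h.orthogonal hJ
  have e1 : g.inner x v (km x) = B.repr v 0 * g.inner x (kp x) (km x) := by
    conv_lhs => rw [← hv]
    simp [hk.right_null, g.symm x a, g.symm x b, ha, hb]
  have e2 : g.inner x v (kp x) = B.repr v 1 * g.inner x (kp x) (km x) := by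
    conv_lhs => rw [← hv]
    simp [hk.left_null, g.symm x a, g.symm x b, ha, hb, g.symm x (km x) (kp x)]
  have e3 : g.inner x v a = B.repr v 2 := by
    conv_lhs => rw [← hv]
    simp [h1, h3, ha, g.symm x b a]
  have e4 : g.inner x v b = B.repr v 3 := by
    conv_lhs => rw [← hv]
    simp [h2, h3, hb]
  rw [e1, e2, e3, e4, mul_div_cancel_right₀ _ hG, mul_div_cancel_right₀ _ hG]
  exact hv.symm

theorem map_eq (hk : g.IsNullPair kp km) (v : TangentSpace (𝓡 4) x) :
    J x v = (g.inner x v (km x) / g.inner x (kp x) (km x)) • km x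
      - (g.inner x v (kp x) / g.inner x (kp x) (km x)) • kp x
      + g.inner x v a • b - g.inner x v b • a := by
  conv_lhs => rw [h.eq_sum hJ hk v]
  simp only [map_add, map_smul, hJ.map_kp, hJ.map_km, h.map, h.map_right hJ, smul_neg]
  abel

end IsUnitaryPair

namespace IsAdmissibleAlmostComplex
variable (hJ : g.IsAdmissibleAlmostComplex o kp km J) (hk : g.IsNullPair kp km)
include hJ hk

/-- Two orthonormal horizontal vectors agree with a unitary pair up to the orientation. -/
theorem isUnitaryPair_of_orthonormal {y : M} {a b : TangentSpace (𝓡 4) y}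
    (ha : a ∈ g.horizontal kp km y) (hb : b ∈ g.horizontal kp km y)
    (haa : g.inner y a a = 1) (hbb : g.inner y b b = 1) (hab : g.inner y a b = 0)
    (hy : y ∈ (trivializationAt E4 (TangentSpace (𝓡 4) : M → Type _) x).baseSet)
    {e : Module.Basis (Fin 4) ℝ (TangentSpace (𝓡 4) y)} (he : e.orientation = o.orient y)
    (hpos : 0 < trivDet x y ![kp y, km y, a, b] * trivDet x y e) :
    g.IsUnitaryPair kp km J y a b := by
  have h : g.IsUnitaryPair kp km J y a (J y a) := ⟨ha, haa, rfl⟩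
  refine ⟨ha, haa, ?_⟩
  have hb' := h.eq_sum hJ hk b
  have hb'' := mem_horizontal.1 hb
  rw [g.symm y b (km y), g.symm y b (kp y), g.symm y b a, hb''.1, hb''.2, hab] at hb'
  -- `b` is orthogonal to `k±` and to `a`, hence a multiple of `J a`, with factor `±1` by length;
  -- positivity of the determinant product excludes `-1`.
  set c := g.inner y b (J y a) with hc
  have hb3 : b = c • J y a := by simpa using hb'
  have hc1 : c * c = 1 := by
    rw [hb3] at hbb
    simpa [h.right_unit hJ] using hbb
  obtain ⟨B, hB, hBo⟩ := (h.isOrientedFrame hJ).oriented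
  have h2 := trivDet_mul_pos hy (he.trans hBo.symm)
  have h3 : trivDet x y ![kp y, km y, a, b] = c * trivDet x y B := by
    have h4 := (trivDet x y).map_update_smul ![kp y, km y, a, J y a] 3 c (J y a)
    have h5 : ∀ v, Function.update ![kp y, km y, a, J y a] 3 v = ![kp y, km y, a, v] := by
      intro v
      funext i
      fin_cases i <;> simp [Function.update]
    rw [h5, h5, ← hb3, smul_eq_mul, ← hB] at h4
    exact h4
  rw [h3, mul_assoc] at hpos
  have hc0 : 0 < c := by
    by_contra hn
    nlinarith
  have : c = 1 := by nlinarith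
  rw [hb3, this, one_smul]

/-- Near each point there is a smooth unitary frame of the horizontal bundle. -/
theorem exists_unitaryFrame (x : M) : ∃ a b : VField M, ∃ W, IsOpen W ∧ x ∈ W ∧
    SmoothOn a W ∧ SmoothOn b W ∧ ∀ y ∈ W, g.IsUnitaryPair kp km J y (a y) (b y) := by
  obtain ⟨v, hv, hv0⟩ := hk.exists_horizontal_ne_zero x
  have hvp := hJ.spacelike x v hv hv0
  have key : ∀ v : TangentSpace (𝓡 4) x, ∀ᶠ y in 𝓝 x,
      SmoothAt (g.horizontalPart kp km (FiberBundle.extend E4 v)) y := fun v ↦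
    (eventually_smoothAt_extend v).mono fun y hy ↦ hk.smoothAt_horizontalPart hy
  have keyx : ∀ v ∈ g.horizontal kp km x,
      g.horizontalPart kp km (FiberBundle.extend E4 v) x = v := by
    intro v hv
    rw [horizontalPart_eq] <;> simp [hv]
  obtain ⟨a, ⟨c, rfl, hc⟩, has, hau⟩ := exists_unit (key v) (by rwa [keyx v hv])
  set a : VField M := c • g.horizontalPart kp km (FiberBundle.extend E4 v) with ha
  have hamem : ∀ y, a y ∈ g.horizontal kp km y := fun y ↦
    Submodule.smul_mem _ _ (hk.horizontalPart_mem _ y)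
  have hpair : g.IsUnitaryPair kp km J x (a x) (J x (a x)) := ⟨hamem x, hau.self_of_nhds, rfl⟩
  -- `J a` cannot be used as second field, since `J` is not yet known to be smooth. Gram–Schmidt is
  -- applied instead to a smooth horizontal extension of its value at `x`.
  set Z := g.horizontalPart kp km (FiberBundle.extend E4 (J x (a x))) with hZ
  have hZx : Z x = J x (a x) := keyx _ (hpair.right_mem hJ)
  set Y : VField M := Z - (fun y ↦ g.inner y (a y) (Z y)) • a with hY
  have hYs : ∀ᶠ y in 𝓝 x, SmoothAt Y y := by
    filter_upwards [has, key (J x (a x))] with y h1 h2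
    exact ContMDiffAt.sub_section h2 ((g.contMDiffAt_inner h1 h2).smul_section h1)
  have hYx : Y x = J x (a x) := by
    simp [hY, hZx, hpair.orthogonal hJ]
  have hYmem : ∀ y, Y y ∈ g.horizontal kp km y := fun y ↦
    Submodule.sub_mem _ (hk.horizontalPart_mem _ y) (Submodule.smul_mem _ _ (hamem y))
  obtain ⟨b, ⟨d, rfl, hd⟩, hbs, hbu⟩ := exists_unit hYs
    (by rw [hYx, hpair.right_unit hJ]; exact one_pos)
  set b : VField M := d • Y with hb
  have hbmem : ∀ y, b y ∈ g.horizontal kp km y := fun y ↦ Submodule.smul_mem _ _ (hYmem y)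
  have hab : ∀ᶠ y in 𝓝 x, g.inner y (a y) (b y) = 0 := by
    filter_upwards [hau] with y hy
    simp [hb, hY, hy]
  have hbx : b x = J x (a x) := by
    have h1 := hbu.self_of_nhds
    simp only [hb, Pi.smul_apply', hYx, map_smul, smul_apply, smul_eq_mul,
      hpair.right_unit hJ, mul_one] at h1
    have h2 : d x = 1 := by nlinarith
    simp [hb, hYx, h2]
  obtain ⟨U, hU, e, hes, heo⟩ := o.locally_frame x
  have hx : x ∈ (trivializationAt E4 (TangentSpace (𝓡 4) : M → Type _) x).baseSet :=
    mem_baseSet_trivializationAt ..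
  -- Positive at `x`, where the frame is `a, J a`, this product stays positive nearby; there it
  -- forces `b = J a`.
  have hdet : ContinuousAt (fun y ↦ trivDet x y ![kp y, km y, a y, b y] * trivDet x y (e y)) x := by
    refine ContinuousAt.mul ?_ (continuousAt_trivDet (X := fun i y ↦ e y i)
      fun i ↦ ContMDiffOn.contMDiffAt (hes i) hU)
    refine (continuousAt_trivDet (X := ![kp, km, a, b]) fun i ↦ ?_).congr (.of_forall fun y ↦ ?_)
    · fin_cases i
      exacts [hk.smoothAt_left x, hk.smoothAt_right x, has.self_of_nhds, hbs.self_of_nhds]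
    · refine congrArg (trivDet x y) ?_
      funext i
      fin_cases i <;> rfl
  have hdet0 : 0 < trivDet x x ![kp x, km x, a x, b x] * trivDet x x (e x) := by
    obtain ⟨B, hB, hBo⟩ := (hpair.isOrientedFrame hJ).oriented
    rw [hbx, ← hB]
    exact trivDet_mul_pos hx ((heo x (mem_of_mem_nhds hU)).trans hBo.symm)
  have hall : ∀ᶠ y in 𝓝 x, SmoothAt a y ∧ SmoothAt b y ∧
      g.IsUnitaryPair kp km J y (a y) (b y) := by
    filter_upwards [has, hbs, hau, hbu, hab, hU, hdet.eventually (lt_mem_nhds hdet0),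
      (trivializationAt E4 (TangentSpace (𝓡 4) : M → Type _) x).open_baseSet.mem_nhds hx]
      with y h1 h2 h3 h4 h5 h6 h7 h8
    exact ⟨h1, h2, hJ.isUnitaryPair_of_orthonormal hk (hamem y) (hbmem y) h3 h4 h5 h8
      (heo y h6) h7⟩
  obtain ⟨W, hW, hWo, hxW⟩ := eventually_nhds_iff.1 hall
  exact ⟨a, b, W, hWo, hxW, (smoothOn_iff hWo).2 fun y hy ↦ (hW y hy).1,
    (smoothOn_iff hWo).2 fun y hy ↦ (hW y hy).2.1, fun y hy ↦ (hW y hy).2.2⟩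

/-- `map_eq` writes `J X` through the metric, `k±` and a smooth unitary frame. -/
theorem smoothAt_apply {X : VField M} (hX : SmoothAt X x) :
    SmoothAt (fun y ↦ J y (X y)) x := by
  obtain ⟨a, b, W, hW, hx, ha, hb, hab⟩ := hJ.exists_unitaryFrame hk x
  have ha := ha.smoothAt hW hx
  have hb := hb.smoothAt hW hx
  have hp := hk.smoothAt_left x
  have hm := hk.smoothAt_right x
  have hG := g.contMDiffAt_inner hp hm
  have h1 := ((((g.contMDiffAt_inner hX hm).div₀ hG (hk.neg x).ne).smul_section hm).sub_section
    (((g.contMDiffAt_inner hX hp).div₀ hG (hk.neg x).ne).smul_section hp)).add_section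
    ((g.contMDiffAt_inner hX ha).smul_section hb) |>.sub_section
    ((g.contMDiffAt_inner hX hb).smul_section ha)
  refine h1.congr_of_eventuallyEq ?_
  filter_upwards [hW.mem_nhds hx] with y hy
  rw [(hab y hy).map_eq hJ hk (X y)]
  rfl

theorem contMDiff : ContMDiff (𝓡 4) ((𝓡 4).prod 𝓘(ℝ, E4 →L[ℝ] E4)) ∞
    (fun x ↦ TotalSpace.mk' (E4 →L[ℝ] E4)
      (E := fun x : M ↦ TangentSpace (𝓡 4) x →L[ℝ] TangentSpace (𝓡 4) x) x (J x)) :=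
  fun _ ↦ contMDiffAt_hom_of_apply fun _ hX ↦ hJ.smoothAt_apply hk hX

theorem sq (x : M) (v : TangentSpace (𝓡 4) x) : J x (J x v) = -v := by
  obtain ⟨a, b, W, hW, hx, ha, hb, hab⟩ := hJ.exists_unitaryFrame hk x
  have h := hab x hx
  rw [h.eq_sum hJ hk v]
  simp only [map_add, map_smul, hJ.map_kp, hJ.map_km, h.map, h.map_right hJ, smul_neg, map_neg]
  abel

end IsAdmissibleAlmostComplex
end SemiRiemannianMetric

/-! ### Shear-freeness and integrability of `J` -/

theorem nijenhuis_map_right {J : (x : M) → TangentSpace (𝓡 4) x →L[ℝ] TangentSpace (𝓡 4) x}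
    (hsq : ∀ x v, J x (J x v) = -v) {X Y : VField M} {x : M} (hY : DiffAt Y x) :
    nijenhuis J X (fun y ↦ J y (Y y)) x = -J x (nijenhuis J X Y x) := by
  have e : (fun y ↦ J y (J y (Y y))) = (-1 : ℝ) • Y := by
    funext y
    simp [hsq]
  simp only [nijenhuis, e]
  rw [mlieBracket_const_smul_right hY, mlieBracket_const_smul_right hY]
  simp only [map_sub, hsq, neg_smul, one_smul, map_neg]
  abel

theorem mvfderiv_eq_zero_of_eventually_const {φ : M → ℝ} {x : M} {c : ℝ}
    (h : ∀ᶠ y in 𝓝 x, φ y = c) : mvfderiv (𝓡 4) φ x = 0 := by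
  have h' : φ =ᶠ[𝓝 x] fun _ ↦ c := h
  rw [← mvfderiv_const (I := 𝓡 4) (M := M) c (x := x), mvfderiv, mvfderiv, h'.mfderiv_eq,
    h'.eq_of_nhds]

namespace SemiRiemannianMetric
variable {g : SemiRiemannianMetric M} {o : TangentOrientation M} {kp km : VField M} {x : M}
  {J : (x : M) → TangentSpace (𝓡 4) x →L[ℝ] TangentSpace (𝓡 4) x}

section Shear

theorem projH_eq {v : TangentSpace (𝓡 4) x} (hv : v ∈ g.horizontal kp km x) :
    g.projH kp km x v = v := by
  rw [mem_horizontal] at hv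
  simp [projH, hv.1, hv.2]

theorem inner_projH (v : TangentSpace (𝓡 4) x) {w : TangentSpace (𝓡 4) x}
    (hw : w ∈ g.horizontal kp km x) : g.inner x (g.projH kp km x v) w = g.inner x v w := by
  rw [mem_horizontal] at hw
  simp [projH, hw.1, hw.2]

theorem inner_relNabla {X : VField M} {v w : TangentSpace (𝓡 4) x}
    (hv : v ∈ g.horizontal kp km x) (hw : w ∈ g.horizontal kp km x) :
    g.inner x (g.relNabla kp km X x v) w = g.inner x (g.leviCivita X x v) w := by
  simp [relNabla, inner_projH _ hw, projH_eq hv]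

/-- On a unitary frame, vanishing shear becomes `g(∇_a X, a) = g(∇_b X, b)` and `g(∇_a X, b) + g(∇_b
X, a) = 0`, the trace being eliminated. -/
theorem inner_relShear {X : VField M} {v w : TangentSpace (𝓡 4) x}
    (hv : v ∈ g.horizontal kp km x) (hw : w ∈ g.horizontal kp km x) :
    2 * g.inner x (g.relShear kp km X x v) w
      = g.inner x (g.leviCivita X x v) w + g.inner x (g.leviCivita X x w) v
        - LinearMap.trace ℝ _ (g.relNabla kp km X x) * g.inner x v w := by
  have h := LinearMap.BilinForm.isAdjointPairLeftAdjointOfNondegenerate (g.bilin x)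
    (g.bilin_nondegenerate x) (g.relNabla kp km X x) v w
  simp only [bilin_apply] at h
  rw [g.symm x v, inner_relNabla hw hv] at h
  simp only [relShear, LinearMap.sub_apply, LinearMap.smul_apply, LinearMap.add_apply, map_sub,
    map_smul, map_add, sub_apply, smul_apply, add_apply, smul_eq_mul,
    inner_relNabla hv hw, h, projH_eq hv]
  ring

/-- The Lie bracket of a shear-free field with a unitary frame is complex linear on the frame. -/
theorem map_mlieBracket_of_isShearFree (hJ : g.IsAdmissibleAlmostComplex o kp km J)
    (hk : g.IsNullPair kp km) {k a b : VField M} (hks : SmoothAt k x)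
    (hshear : g.IsShearFree kp km k) (ha : SmoothAt a x) (hb : SmoothAt b x)
    (hab : ∀ᶠ y in 𝓝 x, g.IsUnitaryPair kp km J y (a y) (b y))
    (h1 : mlieBracket (𝓡 4) k a x ∈ g.horizontal kp km x)
    (h2 : mlieBracket (𝓡 4) k b x ∈ g.horizontal kp km x) :
    J x (mlieBracket (𝓡 4) k a x) = mlieBracket (𝓡 4) k b x := by
  have h := hab.self_of_nhds
  have ham := h.mem
  have hbm := h.right_mem hJ
  have maa := g.leviCivita_metric hks.diffAt ha.diffAt ha.diffAt
  have mbb := g.leviCivita_metric hks.diffAt hb.diffAt hb.diffAt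
  have mab := g.leviCivita_metric hks.diffAt ha.diffAt hb.diffAt
  rw [mvfderiv_eq_zero_of_eventually_const (hab.mono fun y hy ↦ hy.unit),
    g.symm x (a x)] at maa
  rw [mvfderiv_eq_zero_of_eventually_const (hab.mono fun y hy ↦ hy.right_unit hJ),
    g.symm x (b x)] at mbb
  rw [mvfderiv_eq_zero_of_eventually_const (hab.mono fun y hy ↦ hy.orthogonal hJ),
    g.symm x (a x)] at mab
  simp only [zero_apply] at maa mbb mab
  have saa := inner_relShear (X := k) ham ham
  have sbb := inner_relShear (X := k) hbm hbm
  have sab := inner_relShear (X := k) ham hbm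
  rw [hshear x _ ham, map_zero, zero_apply, h.unit] at saa
  rw [hshear x _ hbm, map_zero, zero_apply, h.right_unit hJ] at sbb
  rw [hshear x _ ham, map_zero, zero_apply, h.orthogonal hJ] at sab
  have h1' := mem_horizontal.1 h1
  have h2' := mem_horizontal.1 h2
  rw [g.symm, g.symm x (km x)] at h1' h2'
  rw [h.map_eq hJ hk, h.eq_sum hJ hk (mlieBracket (𝓡 4) k b x), h1'.1, h1'.2, h2'.1, h2'.2]
  -- In `[k, a] = ∇_k a - ∇_a k` the terms `∇_k a`, `∇_k b` contribute only a skew part, because the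
  -- frame is orthonormal near `x`; the rest is the shear condition.
  have e1 : g.inner x (mlieBracket (𝓡 4) k a x) (a x)
      = g.inner x (mlieBracket (𝓡 4) k b x) (b x) := by
    rw [← g.leviCivita_torsion hks.diffAt ha.diffAt, ← g.leviCivita_torsion hks.diffAt hb.diffAt]
    simp only [map_sub, sub_apply]
    linarith
  have e2 : g.inner x (mlieBracket (𝓡 4) k a x) (b x)
      = -g.inner x (mlieBracket (𝓡 4) k b x) (a x) := by
    rw [← g.leviCivita_torsion hks.diffAt ha.diffAt, ← g.leviCivita_torsion hks.diffAt hb.diffAt]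
    simp only [map_sub, sub_apply]
    linarith
  rw [e1, e2]
  module

end Shear

/-- A local horizontal vector field agrees near a point with a global one. -/
theorem exists_global_horizontal [T2Space M] {X : VField M} {W : Set M} (hW : IsOpen W)
    (hx : x ∈ W) (hX : SmoothOn X W) (hXm : ∀ y ∈ W, X y ∈ g.horizontal kp km y) :
    ∃ X' : VField M, SmoothOn X' Set.univ ∧ (∀ y, X' y ∈ g.horizontal kp km y) ∧
      X' =ᶠ[𝓝 x] X := by
  obtain ⟨f, -, hf⟩ := (SmoothBumpFunction.nhds_basis_tsupport (I := 𝓡 4) x).mem_iff.1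
    (hW.mem_nhds hx)
  refine ⟨(f : M → ℝ) • X, ?_, fun y ↦ ?_, ?_⟩
  · exact (ContMDiffOn.smul_section_of_tsupport f.contMDiff.contMDiffOn hW hf hX).contMDiffOn
  · by_cases hy : y ∈ W
    · exact Submodule.smul_mem _ _ (hXm y hy)
    · have : f y = 0 := image_eq_zero_of_notMem_tsupport fun h ↦ hy (hf h)
      simp [this]
  · filter_upwards [f.eventuallyEq_one] with y hy
    rw [Pi.smul_apply', hy]
    exact one_smul ..

namespace IsAdmissibleComplex
variable (hJ : g.IsAdmissibleComplex o kp km J)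
include hJ

/-- Admissibility speaks of global horizontal fields. Brackets are local, so a cutoff, available on
a Hausdorff manifold, transfers it to local frames. -/
theorem mlieBracket_kp_mem [T2Space M] {X : VField M} {W : Set M} (hW : IsOpen W)
    (hx : x ∈ W) (hX : SmoothOn X W) (hXm : ∀ y ∈ W, X y ∈ g.horizontal kp km y) :
    mlieBracket (𝓡 4) kp X x ∈ g.horizontal kp km x := by
  obtain ⟨X', h1, h2, h3⟩ := exists_global_horizontal hW hx hX hXm
  rw [← Filter.EventuallyEq.mlieBracket_vectorField_eq (.refl _ kp) h3]
  exact hJ.bracket_kp X' h1 h2 x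

theorem mlieBracket_km_mem [T2Space M] {X : VField M} {W : Set M} (hW : IsOpen W)
    (hx : x ∈ W) (hX : SmoothOn X W) (hXm : ∀ y ∈ W, X y ∈ g.horizontal kp km y) :
    mlieBracket (𝓡 4) km X x ∈ g.horizontal kp km x := by
  obtain ⟨X', h1, h2, h3⟩ := exists_global_horizontal hW hx hX hXm
  rw [← Filter.EventuallyEq.mlieBracket_vectorField_eq (.refl _ km) h3]
  exact hJ.bracket_km X' h1 h2 x

/-- An admissible complex structure defined by shear-free fields is integrable. -/
theorem nijenhuis_eq_zero [T2Space M] (hk : g.IsNullPair kp km) (hp : g.IsShearFree kp km kp)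
    (hm : g.IsShearFree kp km km) {X Y : VField M} (hX : DiffAt X x) (hY : DiffAt Y x) :
    nijenhuis J X Y x = 0 := by
  have hJ' := hJ.toIsAdmissibleAlmostComplex
  obtain ⟨a, b, W, hW, hx, ha, hb, hab⟩ := hJ'.exists_unitaryFrame hk x
  have hsq := hJ'.sq hk
  have hJd : DiffEndAt J x := (hJ'.contMDiff hk).mdifferentiableAt (by simp)
  set N := nijenhuisHom hJd (hsq x) with hN
  have hswap : ∀ v w, N v w = -N w v := fun v w ↦ nijenhuis_swap ..
  have hself : ∀ v, N v v = 0 := fun v ↦ by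
    have h2 : (2 : ℝ) • N v v = 0 := by
      rw [two_smul]
      nth_rw 1 [hswap]
      exact neg_add_cancel _
    exact (smul_eq_zero.1 h2).resolve_left two_ne_zero
  have hmap : ∀ v w, N v (J x w) = -J x (N v w) := by
    intro v w
    have hv : DiffAt (FiberBundle.extend E4 v) x := FiberBundle.mdifferentiableAt_extend ..
    have hw : DiffAt (FiberBundle.extend E4 w) x := FiberBundle.mdifferentiableAt_extend ..
    have h1 := nijenhuis_map_right hsq (X := FiberBundle.extend E4 v) hw
    rw [← nijenhuisHom_apply hJd (hsq x) hv hw,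
      ← nijenhuisHom_apply hJd (hsq x) hv (hJd.apply hw)] at h1
    simpa using h1
  have hev : ∀ᶠ y in 𝓝 x, g.IsUnitaryPair kp km J y (a y) (b y) :=
    (hW.eventually_mem hx).mono fun y hy ↦ hab y hy
  have h := hab x hx
  have ham : ∀ y ∈ W, a y ∈ g.horizontal kp km y := fun y hy ↦ (hab y hy).mem
  have hbm : ∀ y ∈ W, b y ∈ g.horizontal kp km y := fun y hy ↦ (hab y hy).right_mem hJ'
  have has := ha.smoothAt hW hx
  have hbs := hb.smoothAt hW hx
  have b1 := map_mlieBracket_of_isShearFree hJ' hk (hk.smoothAt_left x) hp has hbs hev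
    (hJ.mlieBracket_kp_mem hW hx ha ham) (hJ.mlieBracket_kp_mem hW hx hb hbm)
  have b2 := map_mlieBracket_of_isShearFree hJ' hk (hk.smoothAt_right x) hm has hbs hev
    (hJ.mlieBracket_km_mem hW hx ha ham) (hJ.mlieBracket_km_mem hW hx hb hbm)
  -- The value is `[k₋, b] - J[k₋, a] - J[k₊, b] - [k₊, a]`; the terms cancel in pairs by `b2`, and
  -- by `b1` with `J² = -1`.
  have hpa : N (kp x) (a x) = 0 := by
    rw [hN, nijenhuisHom_apply hJd (hsq x) (hk.smoothAt_left x).diffAt has.diffAt, nijenhuis]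
    have e1 : (fun y ↦ J y (kp y)) = km := funext hJ'.map_kp
    have e2 : (fun y ↦ J y (a y)) =ᶠ[𝓝 x] b := hev.mono fun y hy ↦ hy.map
    rw [e1, Filter.EventuallyEq.mlieBracket_vectorField_eq (.refl _ km) e2,
      Filter.EventuallyEq.mlieBracket_vectorField_eq (.refl _ kp) e2, b2, ← b1, hsq]
    abel
  -- Antilinearity extends vanishing from `k₊, a` to `J k₊ = k₋` and `J a = b`, hence to the whole
  -- frame.
  have key : ∀ v, N v (kp x) = 0 → N v (a x) = 0 → ∀ w, N v w = 0 := by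
    intro v h1 h2 w
    have h3 : N v (km x) = 0 := by rw [← hJ'.map_kp, hmap, h1, map_zero, neg_zero]
    have h4 : N v (b x) = 0 := by rw [← h.map, hmap, h2, map_zero, neg_zero]
    rw [h.eq_sum hJ' hk w]
    simp [h1, h2, h3, h4]
  -- Applied first to `k₊` and to `a`, `key` with skewness supplies its own hypotheses for arbitrary
  -- `v`.
  have hzero : ∀ v w, N v w = 0 := fun v ↦ key v
    (by rw [hswap, key _ (hself _) hpa, neg_zero])
    (by rw [hswap, key _ (by rw [hswap, hpa, neg_zero]) (hself _), neg_zero])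
  rw [← nijenhuisHom_apply hJd (hsq x) hX hY]
  exact hzero _ _

end IsAdmissibleComplex
end SemiRiemannianMetric

/-! ### The form `d(q k₊♭)` in a unitary frame, and the Kähler structure -/

namespace SemiRiemannianMetric
variable {g : SemiRiemannianMetric M} {o : TangentOrientation M} {kp km : VField M} {x : M}
  {J : (x : M) → TangentSpace (𝓡 4) x →L[ℝ] TangentSpace (𝓡 4) x} {q : M → ℝ}

theorem IsNullPair.smoothForm (hk : g.IsNullPair kp km) (hq : ContMDiff (𝓡 4) 𝓘(ℝ) ∞ q) :
    SmoothForm (fun y ↦ q y • g.inner y (kp y)) := by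
  intro x
  refine contMDiffAt_hom_of_apply (V := Bundle.Trivial M ℝ) fun X hX ↦ ?_
  rw [contMDiffAt_totalSpace]
  exact ⟨contMDiffAt_id, hq.contMDiffAt.mul (g.contMDiffAt_inner (hk.smoothAt_left x) hX)⟩

section Form
variable (hk : g.IsNullPair kp km)
include hk

/-- As `k₊` is null and geodesic, the undifferentiated `q` is multiplied only by `g(k₊, ∇_{k₋} k₊)`,
half the derivative of `g(k₊, k₊) = 0`. -/
theorem dOneForm_kp_km (hq : ContMDiff (𝓡 4) 𝓘(ℝ) ∞ q) (hgeo : g.IsGeodesic kp) (x : M) :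
    dOneForm (fun y ↦ q y • g.inner y (kp y)) kp km x
      = mvfderiv (𝓡 4) q x (kp x) * g.inner x (kp x) (km x) := by
  have hp := (hk.smoothAt_left x).diffAt
  have hm := (hk.smoothAt_right x).diffAt
  have m1 := g.leviCivita_metric hp hp hm
  have m2 := g.leviCivita_metric hm hp hp
  rw [mvfderiv_eq_zero_of_eventually_const (.of_forall hk.left_null), g.symm x (kp x)] at m2
  rw [hgeo x] at m1
  have t := congrArg (g.inner x (kp x)) (g.leviCivita_torsion hp hm)
  rw [map_sub] at t
  have hd := mvfderiv_fun_mul (hq.mdifferentiable (by simp) x) (g.mdifferentiableAt_inner hp hm)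
  have hz : mvfderiv (𝓡 4) (fun y ↦ q y * g.inner y (kp y) (kp y)) x = 0 :=
    mvfderiv_eq_zero_of_eventually_const (c := 0) (.of_forall fun y ↦ by simp [hk.left_null])
  simp only [dOneForm, smul_apply, smul_eq_mul, hd, hz, add_apply, zero_apply, ← t, m1, map_zero]
  rw [g.symm x (kp x) (g.leviCivita kp x (km x))]
  simp only [zero_apply] at m2
  linear_combination (-q x / 2) * m2

theorem dOneForm_kp_horizontal {X : VField M}
    (hX : ∀ᶠ y in 𝓝 x, X y ∈ g.horizontal kp km y)
    (hb : mlieBracket (𝓡 4) kp X x ∈ g.horizontal kp km x) :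
    dOneForm (fun y ↦ q y • g.inner y (kp y)) kp X x = 0 := by
  have hz1 : mvfderiv (𝓡 4) (fun y ↦ q y * g.inner y (kp y) (X y)) x = 0 :=
    mvfderiv_eq_zero_of_eventually_const (c := 0) (hX.mono fun y hy ↦ by
      simp [(mem_horizontal.1 hy).1])
  have hz2 : mvfderiv (𝓡 4) (fun y ↦ q y * g.inner y (kp y) (kp y)) x = 0 :=
    mvfderiv_eq_zero_of_eventually_const (c := 0) (.of_forall fun y ↦ by simp [hk.left_null])
  simp [dOneForm, hz1, hz2, (mem_horizontal.1 hb).1]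

omit hk in
theorem dOneForm_km_horizontal {X : VField M}
    (hX : ∀ᶠ y in 𝓝 x, X y ∈ g.horizontal kp km y)
    (hb : mlieBracket (𝓡 4) km X x ∈ g.horizontal kp km x)
    (hgrad : mvfderiv (𝓡 4) (fun y ↦ q y * g.inner y (kp y) (km y)) x (X x) = 0) :
    dOneForm (fun y ↦ q y • g.inner y (kp y)) km X x = 0 := by
  have hz1 : mvfderiv (𝓡 4) (fun y ↦ q y * g.inner y (kp y) (X y)) x = 0 :=
    mvfderiv_eq_zero_of_eventually_const (c := 0) (hX.mono fun y hy ↦ by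
      simp [(mem_horizontal.1 hy).1])
  simp [dOneForm, hz1, hgrad, (mem_horizontal.1 hb).1]

/-- `α` vanishes on horizontal fields, so only `-q g(k₊, [a, b])` remains; differentiating `g(k₊, a)
= g(k₊, b) = 0` turns `g(k₊, [a, b])` into the twist. -/
theorem dOneForm_horizontal_horizontal {a b : VField M} (ha : DiffAt a x) (hb : DiffAt b x)
    (ham : ∀ᶠ y in 𝓝 x, a y ∈ g.horizontal kp km y)
    (hbm : ∀ᶠ y in 𝓝 x, b y ∈ g.horizontal kp km y) :
    dOneForm (fun y ↦ q y • g.inner y (kp y)) a b x = -(q x * g.twist kp x (a x) (b x)) := by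
  have hp := (hk.smoothAt_left x).diffAt
  have hz : ∀ {X : VField M}, (∀ᶠ y in 𝓝 x, X y ∈ g.horizontal kp km y) →
      mvfderiv (𝓡 4) (fun y ↦ q y * g.inner y (kp y) (X y)) x = 0 := fun hX ↦
    mvfderiv_eq_zero_of_eventually_const (c := 0) (hX.mono fun y hy ↦ by
      simp [(mem_horizontal.1 hy).1])
  have m1 := g.leviCivita_metric ha hp hb
  have m2 := g.leviCivita_metric hb hp ha
  rw [mvfderiv_eq_zero_of_eventually_const (hbm.mono fun y hy ↦ (mem_horizontal.1 hy).1)] at m1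
  rw [mvfderiv_eq_zero_of_eventually_const (ham.mono fun y hy ↦ (mem_horizontal.1 hy).1)] at m2
  have t := congrArg (g.inner x (kp x)) (g.leviCivita_torsion ha hb)
  rw [map_sub] at t
  simp only [zero_apply] at m1 m2
  simp only [dOneForm, smul_apply, smul_eq_mul, hz ham, hz hbm, zero_apply, ← t, twist]
  linear_combination q x * m1 - q x * m2

end Form

/-- The bilinear form `(v, w) ↦ dα (v, J w)`. -/
def dOneFormTwist (α : (x : M) → TangentSpace (𝓡 4) x →L[ℝ] ℝ) (hα : SmoothForm α)
    (J : (x : M) → TangentSpace (𝓡 4) x →L[ℝ] TangentSpace (𝓡 4) x) (x : M) :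
    TangentSpace (𝓡 4) x →L[ℝ] TangentSpace (𝓡 4) x →L[ℝ] ℝ :=
  (ContinuousLinearMap.precomp ℝ (J x)).comp (dOneFormHom α hα x)

theorem dOneFormTwist_apply {α : (x : M) → TangentSpace (𝓡 4) x →L[ℝ] ℝ} (hα : SmoothForm α)
    (v w : TangentSpace (𝓡 4) x) :
    dOneFormTwist α hα J x v w = dOneFormHom α hα x v (J x w) := rfl

theorem eventually_diffAt {X : VField M} (hX : SmoothAt X x) : ∀ᶠ y in 𝓝 x, DiffAt X y := by
  have : IsManifold (𝓡 4) 1 M := .of_le (n := ∞) (by simp)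
  have h := (contMDiffAt_iff_contMDiffAt_nhds (by simp)).1
    (ContMDiffAt.of_le hX (natCast_le_infty 1))
  exact h.mono fun y hy ↦ hy.mdifferentiableAt (by simp)

/-- The test on vector fields is applied once in each argument, reducing to the smoothness of `dα(X,
J Y)`. -/
theorem contMDiff_dOneFormTwist {α : (x : M) → TangentSpace (𝓡 4) x →L[ℝ] ℝ} (hα : SmoothForm α)
    (hJ : ∀ {x : M} {X : VField M}, SmoothAt X x → SmoothAt (fun y ↦ J y (X y)) x) :
    ContMDiff (𝓡 4) ((𝓡 4).prod 𝓘(ℝ, E4 →L[ℝ] E4 →L[ℝ] ℝ)) ∞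
    (fun x ↦ TotalSpace.mk' (E4 →L[ℝ] E4 →L[ℝ] ℝ)
      (E := fun x : M ↦ TangentSpace (𝓡 4) x →L[ℝ] TangentSpace (𝓡 4) x →L[ℝ] ℝ) x
      (dOneFormTwist α hα J x)) := by
  intro x
  have key : ∀ {X Y : VField M}, SmoothAt X x → SmoothAt Y x →
      ContMDiffAt (𝓡 4) 𝓘(ℝ) ∞ (fun y ↦ dOneFormTwist α hα J y (X y) (Y y)) x := by
    intro X Y hX hY
    refine (hα.contMDiffAt_dOneForm hX (hJ hY)).congr_of_eventuallyEq ?_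
    filter_upwards [eventually_diffAt hX, eventually_diffAt (hJ hY)] with y h1 h2
    rw [dOneFormTwist_apply]
    exact dOneFormHom_apply (Y := fun y ↦ J y (Y y)) hα h1 h2
  have key' : ∀ {X : VField M}, SmoothAt X x →
      ContMDiffAt (𝓡 4) ((𝓡 4).prod 𝓘(ℝ, E4 →L[ℝ] ℝ)) ∞
        (fun y ↦ TotalSpace.mk' (E4 →L[ℝ] ℝ)
          (E := fun x : M ↦ TangentSpace (𝓡 4) x →L[ℝ] Bundle.Trivial M ℝ x) y
          (dOneFormTwist α hα J y (X y))) x := by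
    intro X hX
    refine contMDiffAt_hom_of_apply (V := Bundle.Trivial M ℝ) fun Y hY ↦ ?_
    rw [contMDiffAt_totalSpace]
    exact ⟨contMDiffAt_id, key hX hY⟩
  exact contMDiffAt_hom_of_apply (F := E4 →L[ℝ] ℝ)
    (V := fun x : M ↦ TangentSpace (𝓡 4) x →L[ℝ] Bundle.Trivial M ℝ x) fun X hX ↦ key' hX

/-- A skew form that pairs only `k₊` with `k₋` and the two horizontal vectors of a unitary pair,
with positive values, is invariant under `J` and tames it. -/
theorem IsUnitaryPair.skew_invariant_and_pos {a b : TangentSpace (𝓡 4) x}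
    (h : g.IsUnitaryPair kp km J x a b)
    (hJ : g.IsAdmissibleAlmostComplex o kp km J) (hk : g.IsNullPair kp km)
    {Ω : TangentSpace (𝓡 4) x →L[ℝ] TangentSpace (𝓡 4) x →L[ℝ] ℝ}
    (hΩ : ∀ v w, Ω v w = -Ω w v) (hpa : Ω (kp x) a = 0) (hpb : Ω (kp x) b = 0)
    (hma : Ω (km x) a = 0) (hmb : Ω (km x) b = 0) (hpm : 0 < Ω (kp x) (km x))
    (hab : 0 < Ω a b) :
    (∀ v w, Ω (J x v) (J x w) = Ω v w) ∧ ∀ v, v ≠ 0 → 0 < Ω v (J x v) := by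
  have hself : ∀ v, Ω v v = 0 := fun v ↦ self_eq_neg.1 (hΩ v v)
  have e : ∀ v, ∃ c₀ c₁ c₂ c₃ : ℝ, v = c₀ • kp x + c₁ • km x + c₂ • a + c₃ • b :=
    fun v ↦ ⟨_, _, _, _, h.eq_sum hJ hk v⟩
  constructor
  · intro v w
    obtain ⟨c₀, c₁, c₂, c₃, rfl⟩ := e v
    obtain ⟨d₀, d₁, d₂, d₃, rfl⟩ := e w
    simp only [map_add, map_smul, hJ.map_kp, hJ.map_km, h.map, h.map_right hJ, add_apply,
      smul_apply, smul_eq_mul, hself, hpa, hpb, hma, hmb, hΩ (km x) (kp x), hΩ b a, hΩ a (kp x),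
      hΩ a (km x), hΩ b (kp x), hΩ b (km x), map_neg, neg_apply]
    ring
  · intro v hv
    obtain ⟨c₀, c₁, c₂, c₃, rfl⟩ := e v
    simp only [map_add, map_smul, hJ.map_kp, hJ.map_km, h.map, h.map_right hJ, add_apply,
      smul_apply, smul_eq_mul, hself, hpa, hpb, hma, hmb, hΩ (km x) (kp x), hΩ b a, hΩ a (kp x),
      hΩ a (km x), hΩ b (kp x), hΩ b (km x), map_neg]
    by_contra hn
    -- The left side is `Ω(v, J v)` in coordinates; were it nonpositive, all coordinates would
    -- vanish.
    have h1 : (c₀ ^ 2 + c₁ ^ 2) * Ω (kp x) (km x) + (c₂ ^ 2 + c₃ ^ 2) * Ω a b ≤ 0 := by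
      linarith
    have h2 : 0 ≤ (c₀ ^ 2 + c₁ ^ 2) * Ω (kp x) (km x) := by positivity
    have h3 : 0 ≤ (c₂ ^ 2 + c₃ ^ 2) * Ω a b := by positivity
    have h4 : c₀ ^ 2 + c₁ ^ 2 = 0 :=
      (mul_eq_zero.1 (by linarith : (c₀ ^ 2 + c₁ ^ 2) * Ω (kp x) (km x) = 0)).resolve_right hpm.ne'
    have h5 : c₂ ^ 2 + c₃ ^ 2 = 0 :=
      (mul_eq_zero.1 (by linarith : (c₂ ^ 2 + c₃ ^ 2) * Ω a b = 0)).resolve_right hab.ne'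
    have h6 : c₀ = 0 ∧ c₁ = 0 := ⟨by nlinarith, by nlinarith⟩
    have h7 : c₂ = 0 ∧ c₃ = 0 := ⟨by nlinarith, by nlinarith⟩
    exact hv (by simp [h6, h7])

/-- The derivative of a function along a horizontal vector vanishes if its gradient is vertical. -/
theorem mvfderiv_eq_zero_of_gradient_mem {φ : M → ℝ}
    (hφ : g.gradient φ x ∈ vertical kp km x) {v : TangentSpace (𝓡 4) x}
    (hv : v ∈ g.horizontal kp km x) : mvfderiv (𝓡 4) φ x v = 0 := by
  rw [mem_horizontal] at hv
  have h1 : g.inner x (g.gradient φ x) v = mvfderiv (𝓡 4) φ x v := g.inner_sharp x _ v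
  obtain ⟨c, d, h2⟩ := Submodule.mem_span_pair.1 hφ
  rw [← h1, ← h2]
  simp [hv.1, hv.2]

/-- All metric properties reduce to `key`: `dα` is `J`-invariant and tames `J` on `U`. -/
theorem IsAdmissibleComplex.isKahlerOn [T2Space M] (hJ : g.IsAdmissibleComplex o kp km J)
    (hk : g.IsNullPair kp km) (hp : g.IsShearFree kp km kp) (hm : g.IsShearFree kp km km)
    (hgeo : g.IsGeodesic kp) (hq : ContMDiff (𝓡 4) 𝓘(ℝ) ∞ q) (hq0 : ∀ x, 0 < q x)
    (hgrad : ∀ x, ∀ v ∈ g.horizontal kp km x,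
      mvfderiv (𝓡 4) (fun y ↦ q y * g.inner y (kp y) (km y)) x v = 0)
    {U : Set M} (hU : IsOpen U)
    (htwist : ∀ x ∈ U, ∀ a b, g.IsOrientedFrame o kp km x a b → g.twist kp x a b < 0)
    (hder : ∀ x ∈ U, mvfderiv (𝓡 4) q x (kp x) < 0) :
    IsKahlerOn U J (dOneFormTwist _ (hk.smoothForm hq) J) := by
  have hJ' := hJ.toIsAdmissibleAlmostComplex
  have hα := hk.smoothForm hq
  have key : ∀ x ∈ U, (∀ v w, dOneFormHom _ hα x (J x v) (J x w) = dOneFormHom _ hα x v w) ∧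
      ∀ v, v ≠ 0 → 0 < dOneFormHom _ hα x v (J x v) := by
    intro x hxU
    obtain ⟨a, b, W, hW, hx, ha, hb, hab⟩ := hJ'.exists_unitaryFrame hk x
    have h := hab x hx
    have ham : ∀ y ∈ W, a y ∈ g.horizontal kp km y := fun y hy ↦ (hab y hy).mem
    have hbm : ∀ y ∈ W, b y ∈ g.horizontal kp km y := fun y hy ↦ (hab y hy).right_mem hJ'
    have ham' := (hW.eventually_mem hx).mono ham
    have hbm' := (hW.eventually_mem hx).mono hbm
    have had := (ha.smoothAt hW hx).diffAt
    have hbd := (hb.smoothAt hW hx).diffAt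
    have hpd := (hk.smoothAt_left x).diffAt
    have hmd := (hk.smoothAt_right x).diffAt
    refine h.skew_invariant_and_pos hJ' hk (dOneFormHom_swap hα) ?_ ?_ ?_ ?_ ?_ ?_
    · rw [dOneFormHom_apply hα hpd had]
      exact dOneForm_kp_horizontal hk ham' (hJ.mlieBracket_kp_mem hW hx ha ham)
    · rw [dOneFormHom_apply hα hpd hbd]
      exact dOneForm_kp_horizontal hk hbm' (hJ.mlieBracket_kp_mem hW hx hb hbm)
    · rw [dOneFormHom_apply hα hmd had]
      exact dOneForm_km_horizontal ham' (hJ.mlieBracket_km_mem hW hx ha ham)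
        (hgrad x _ h.mem)
    · rw [dOneFormHom_apply hα hmd hbd]
      exact dOneForm_km_horizontal hbm' (hJ.mlieBracket_km_mem hW hx hb hbm)
        (hgrad x _ (h.right_mem hJ'))
    · rw [dOneFormHom_apply hα hpd hmd, dOneForm_kp_km hk hq hgeo]
      exact mul_pos_of_neg_of_neg (hder x hxU) (hk.neg x)
    · rw [dOneFormHom_apply hα had hbd, dOneForm_horizontal_horizontal hk had hbd ham' hbm',
        neg_pos]
      exact mul_neg_of_pos_of_neg (hq0 x) (htwist x hxU _ _ (h.isOrientedFrame hJ'))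
  have hsq := hJ'.sq hk
  refine ⟨(hJ'.contMDiff hk).contMDiffOn, fun x _ v ↦ hsq x v, fun X Y hX hY x hx ↦
    hJ.nijenhuis_eq_zero hk hp hm (hX.smoothAt hU hx).diffAt (hY.smoothAt hU hx).diffAt,
    (contMDiff_dOneFormTwist hα (hJ'.smoothAt_apply hk)).contMDiffOn, fun x hx v w ↦ ?_,
    fun x hx ↦ (key x hx).2, fun x hx v w ↦ (key x hx).1 v (J x w), fun X Y Z hX hY hZ x hx ↦ ?_⟩
  -- `dα(v, J w) = dα(J v, J J w) = -dα(J v, w) = dα(w, J v)`.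
  · rw [dOneFormTwist_apply, dOneFormTwist_apply, ← (key x hx).1, hsq, map_neg, dOneFormHom_swap,
      neg_neg]
  · rw [← dTwoForm_dOneForm hα hU hX hY hZ hx]
    refine dTwoForm_congr ((hU.eventually_mem hx).mono fun y hy ↦ ?_)
    funext v w
    exact (key y hy).1 v w

end SemiRiemannianMetric
end KahlerLorentz
end

theorem mainTheorem6 {M : Type*} [TopologicalSpace M] [T2Space M] [SecondCountableTopology M]
    [ChartedSpace E4 M] [IsManifold (𝓡 4) ∞ M]
    (g : SemiRiemannianMetric M) (o : TangentOrientation M) (hg : g.IsPetrovTypeD)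
    (kp km : VField M) (hkp : SmoothOn kp Set.univ) (hkm : SmoothOn km Set.univ)
    (hkp_null : g.IsNull kp) (hkm_null : g.IsNull km)
    (hkp_shear : g.IsShearFree kp km kp) (hkm_shear : g.IsShearFree kp km km)
    (hkp_geo : g.IsGeodesic kp) (hkm_geo : g.IsPreGeodesic km)
    (hneg : ∀ x, g.inner x (kp x) (km x) < 0)
    (J : (x : M) → TangentSpace (𝓡 4) x →L[ℝ] TangentSpace (𝓡 4) x)
    (hJ : g.IsAdmissibleComplex o kp km J)
    (p : M → ℝ) (hp : p = fun x ↦ 1 / √(-g.inner x (kp x) (km x)))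
    (u : M → ℝ) (hu : ContMDiff (𝓡 4) 𝓘(ℝ) ∞ u)
    (f : ℝ → ℝ) (hf : ContDiffOn ℝ ∞ f (Set.range u)) (hf_pos : ∀ t ∈ Set.range u, 0 < f t)
    (hgrad : ∀ x, g.gradient (fun y ↦ f (u y) / p y) x ∈ vertical kp km x)
    (U : Set M) (hU : IsOpen U)
    (htwist : ∀ x ∈ U, ∀ a b, g.IsOrientedFrame o kp km x a b → g.twist kp x a b < 0)
    (hder : ∀ x ∈ U, mvfderiv (𝓡 4) (fun y ↦ f (u y) * p y) x (kp x) < 0) :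
    ∃ gK : (x : M) → TangentSpace (𝓡 4) x →L[ℝ] TangentSpace (𝓡 4) x →L[ℝ] ℝ,
      (∀ x ∈ U, ∀ v w, gK x v w =
        dOneFormAt (fun y ↦ (f (u y) * p y) • g.inner y (kp y)) x v (J x w)) ∧
      IsKahlerOn U J gK := by
  have hk : g.IsNullPair kp km :=
    ⟨hkp, hkm, fun x ↦ (hkp_null x).2, fun x ↦ (hkm_null x).2, hneg⟩
  have hps : ContMDiff (𝓡 4) 𝓘(ℝ) ∞ p := by
    intro x
    have hG : 0 < -g.inner x (kp x) (km x) := neg_pos.2 (hneg x)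
    have h1 : ContMDiffAt (𝓡 4) 𝓘(ℝ) ∞ (fun y ↦ √(-g.inner y (kp y) (km y))) x :=
      (Real.contDiffAt_sqrt hG.ne').contMDiffAt.comp x
        (g.contMDiffAt_inner (hk.smoothAt_left x) (hk.smoothAt_right x)).neg
    rw [hp]
    exact contMDiffAt_const.div₀ h1 (Real.sqrt_pos.2 hG).ne'
  have hp0 : ∀ x, 0 < p x := fun x ↦ by
    have := neg_pos.2 (hneg x)
    rw [hp]
    positivity
  -- `f` need only be smooth within the range of `u`, as all values of `u` lie there.
  have hfu : ContMDiff (𝓡 4) 𝓘(ℝ) ∞ (fun x ↦ f (u x)) := contMDiffOn_univ.1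
    (hf.contMDiffOn.comp hu.contMDiffOn fun x _ ↦ Set.mem_range_self x)
  have hq : ContMDiff (𝓡 4) 𝓘(ℝ) ∞ (fun y ↦ f (u y) * p y) := hfu.mul hps
  -- Since `g(k₊, k₋) = -1/p²`, the gradient hypothesis is precisely what the mixed terms `dα(k₋,
  -- ·)` require.
  have hqG : (fun y ↦ f (u y) * p y * g.inner y (kp y) (km y)) = -fun y ↦ f (u y) / p y := by
    funext y
    have h1 : 0 < -g.inner y (kp y) (km y) := neg_pos.2 (hneg y)
    have h2 : p y * p y * -g.inner y (kp y) (km y) = 1 := by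
      rw [hp]
      field_simp
      rw [Real.sq_sqrt h1.le]
    have h3 := (hp0 y).ne'
    rw [Pi.neg_apply, eq_neg_iff_add_eq_zero]
    field_simp
    linear_combination (-f (u y)) * h2
  refine ⟨_, fun x _ v w ↦ rfl, hJ.isKahlerOn hk hkp_shear hkm_shear hkp_geo hq
    (fun x ↦ mul_pos (hf_pos _ (Set.mem_range_self x)) (hp0 x)) (fun x v hv ↦ ?_) hU htwist hder⟩
  rw [hqG, mvfderiv_neg, neg_apply,
    SemiRiemannianMetric.mvfderiv_eq_zero_of_gradient_mem (hgrad x) hv, neg_zero]
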